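/- Let $M$ be a smooth manifold with a Riemannian metric $g_M$, and let $(\phi,\xi,\eta)$ be an almost contact metric structure on $(M,g_M)$: a $(1,1)$-tensor field $\phi$, a vector field $\xi$ and a one-form $\eta$, all smooth, such that $\phi^2=-I+\eta\otimes\xi$, $\phi\xi=0$, $\eta\circ\phi=0$, $\eta(\xi)=1$, $g_M(\phi X,\phi Y)=g_M(X,Y)-\eta(X)\eta(Y)$ and $\eta(X)=g_M(X,\xi)$. Suppose that this structure is cosymplectic, that is, it is normal ($[\phi,\phi]+2\,d\eta\otimes\xi=0$, where $[\phi,\phi]$ is the Nijenhuis tensor of $\phi$) and both $\eta$ and the fundamental two-form $\Phi(X,Y)=g_M(X,\phi Y)$ are closed. Let $(N,g_N)$ be a Riemannian manifold and let $F:M\to N$ be a Riemannian submersion, that is, a smooth surjective map whose differential $F_*$ has maximal rank (is surjective) at every point and preserves the lengths of horizontal vectors, i.e. of vectors in $(\ker F_*)^\perp$. Suppose that $F$ is anti-invariant, i.e. $\phi(\ker F_*)\subseteq(\ker F_*)^{\perp}$, and that $$(\ker F_*)^{\perp}=\phi(\ker F_*)\oplus\langle\xi\rangle .$$ Let $\nabla$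 be the Levi-Civita connection of $g_M$, let $\mathcal V$ and $\mathcal H$ be the orthogonal projections of $TM$ onto $\ker F_*$ and $(\ker F_*)^\perp$, and for vector fields $X,Y$ on $M$ let $$\mathcal T_XY=\mathcal H\nabla_{\mathcal VX}\mathcal VY+\mathcal V\nabla_{\mathcal VX}\mathcal HY,\qquad \mathcal A_XY=\mathcal V\nabla_{\mathcal HX}\mathcal HY+\mathcal H\nabla_{\mathcal HX}\mathcal VY$$ be O'Neill's tensors. Let $(\nabla F_*)(X,Y)=\nabla^F_X(F_*Y)-F_*(\nabla_XY)$ be the second fundamental form of $F$, where $\nabla^F$ is the pullback to $F^{-1}TN$ of the Levi-Civita connection of $g_N$. Then $F$ is a totally geodesic map, i.e. $\nabla F_*=0$, if and only if $$\mathcal T_W\phi V=0\ \text{ for all } V,W\in\Gamma(\ker F_*)\quad\text{and}\quad \mathcal A_X\phi W=0\ \text{ for all } X\in\Gamma((\ker F_*)^{\perp}),\ W\in\Gamma(\ker F_*),$$ where $\Gamma$ denotes smooth sections. -/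

import Mathlib

open scoped Manifold ContDiff Bundle
open Bundle

set_option linter.unusedSectionVars false

noncomputable section

namespace CosymplecticSubmersion

section LeviCivita

variable {E : Type*} [NormedAddCommGroup E] [NormedSpace ℝ E] [FiniteDimensional ℝ E]
  {H : Type*} [TopologicalSpace H] {I : ModelWithCorners ℝ E H}
  {M : Type*} [TopologicalSpace M] [ChartedSpace H M] [IsManifold I ∞ M]
  [RiemannianBundle (fun x : M => TangentSpace I x)]
  [IsContMDiffRiemannianBundle I ∞ E (fun x : M => TangentSpace I x)]

instance finiteDimensional_tangentSpace (x : M) : FiniteDimensional ℝ (TangentSpace I x) :=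
  inferInstanceAs (FiniteDimensional ℝ E)

instance completeSpace_tangentSpace (x : M) : CompleteSpace (TangentSpace I x) :=
  FiniteDimensional.complete ℝ _

/-- The function `g(X, Y)`. -/
def ip (X Y : Π x : M, TangentSpace I x) : M → ℝ := fun x => inner ℝ (X x) (Y x)

/-- The right-hand side of Koszul's formula for `g(∇_X Y, Z)`. -/
def koszul (Y X Z : Π x : M, TangentSpace I x) (x : M) : ℝ :=
  (1 / 2 : ℝ) * (d% (ip Y Z) x (X x) + d% (ip X Z) x (Y x) - d% (ip X Y) x (Z x)
    + inner ℝ (VectorField.mlieBracket I X Y x) (Z x)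
    - inner ℝ (VectorField.mlieBracket I X Z x) (Y x)
    - inner ℝ (VectorField.mlieBracket I Y Z x) (X x))

variable {X X' Y Y' Z Z' : Π x : M, TangentSpace I x} {f : M → ℝ} {x : M}

lemma mdiff_ip (hX : MDiffAt (T% X) x) (hY : MDiffAt (T% Y) x) : MDiffAt (ip X Y) x :=
  MDifferentiableAt.inner_bundle (E := fun x : M => TangentSpace I x) (b := id) hX hY

lemma ip_comm : ip X Y = ip Y X := by
  funext x; exact real_inner_comm _ _

lemma d_ip_add_left (hX : MDiffAt (T% X) x) (hX' : MDiffAt (T% X') x) (hY : MDiffAt (T% Y) x)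
    (v : TangentSpace I x) :
    d% (ip (X + X') Y) x v = d% (ip X Y) x v + d% (ip X' Y) x v := by
  have : ip (X + X') Y = ip X Y + ip X' Y := by
    funext y; simp [ip, inner_add_left]
  rw [this, mvfderiv_add (mdiff_ip hX hY) (mdiff_ip hX' hY)]
  rfl

lemma d_ip_smul_left (hf : MDiffAt f x) (hX : MDiffAt (T% X) x) (hY : MDiffAt (T% Y) x)
    (v : TangentSpace I x) :
    d% (ip (f • X) Y) x v = f x * d% (ip X Y) x v + ip X Y x * d% f x v := by
  have : ip (f • X) Y = f * ip X Y := by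
    funext y; simp [ip, inner_smul_left]
  rw [this, mvfderiv_mul hf (mdiff_ip hX hY)]
  simp

lemma d_ip_add_right (hX : MDiffAt (T% X) x) (hX' : MDiffAt (T% X') x) (hY : MDiffAt (T% Y) x)
    (v : TangentSpace I x) :
    d% (ip Y (X + X')) x v = d% (ip Y X) x v + d% (ip Y X') x v := by
  rw [ip_comm, d_ip_add_left hX hX' hY, ip_comm (X := X), ip_comm (X := X')]

lemma d_ip_smul_right (hf : MDiffAt f x) (hX : MDiffAt (T% X) x) (hY : MDiffAt (T% Y) x)
    (v : TangentSpace I x) :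
    d% (ip Y (f • X)) x v = f x * d% (ip Y X) x v + ip Y X x * d% f x v := by
  rw [ip_comm, d_ip_smul_left hf hX hY, ip_comm (X := X)]

open VectorField in
lemma koszul_tensorial_left (hY : MDiffAt (T% Y) x) (hZ : MDiffAt (T% Z) x) :
    TensorialAt I E (koszul Y · Z x) x where
  smul {f X} hf hX := by
    simp only [koszul, d_ip_smul_left hf hX hZ, d_ip_smul_left hf hX hY,
      mlieBracket_smul_left hf hX, Pi.smul_apply', map_smul, inner_add_left, inner_smul_left,
      inner_smul_right, smul_eq_mul, ip, RCLike.conj_to_real]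
    ring
  add hX hX' := by
    simp only [koszul, d_ip_add_left hX hX' hZ, d_ip_add_left hX hX' hY,
      mlieBracket_add_left hX hX', Pi.add_apply, map_add, inner_add_left,
      inner_add_right]
    ring


open VectorField in
lemma koszul_tensorial_right (hY : MDiffAt (T% Y) x) (hX : MDiffAt (T% X) x) :
    TensorialAt I E (koszul Y X · x) x where
  smul {f Z} hf hZ := by
    simp only [koszul, d_ip_smul_right hf hZ hY, d_ip_smul_right hf hZ hX,
      mlieBracket_smul_right hf hZ, Pi.smul_apply', map_smul, inner_add_left, inner_smul_left,
      inner_smul_right, smul_eq_mul, ip, RCLike.conj_to_real]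
    rw [real_inner_comm (Z x) (X x), real_inner_comm (Z x) (Y x)]
    ring
  add hZ hZ' := by
    simp only [koszul, d_ip_add_right hZ hZ' hY, d_ip_add_right hZ hZ' hX,
      mlieBracket_add_right hZ hZ', Pi.add_apply, map_add, inner_add_left,
      inner_add_right]
    ring

open scoped Classical in
/-- The Levi-Civita derivative `X ↦ ∇_X Y` of the vector field `Y` at the point `x`: the linear map
that Koszul's formula determines if `Y` is differentiable at `x`, and the junk value `0` if not. -/
def leviCivitaFun (Y : Π x : M, TangentSpace I x) (x : M) :
    TangentSpace I x →L[ℝ] TangentSpace I x :=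
  if hY : MDiffAt (T% Y) x then
    let B : TangentSpace I x →L[ℝ] TangentSpace I x →L[ℝ] ℝ :=
      TensorialAt.mkHom₂ (I := I) (F := E) (F' := E) (fun X Z => koszul Y X Z x) x
        (fun _ hZ => koszul_tensorial_left hY hZ) (fun _ hX => koszul_tensorial_right hY hX)
    LinearMap.toContinuousLinearMap
      { toFun := fun v => (InnerProductSpace.toDual ℝ (TangentSpace I x)).symm (B v)
        map_add' := fun v w => by simp
        map_smul' := fun c v => by simp }
  else 0

lemma inner_leviCivitaFun (hX : MDiffAt (T% X) x) (hY : MDiffAt (T% Y) x) (hZ : MDiffAt (T% Z) x) :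
    inner ℝ (leviCivitaFun Y x (X x)) (Z x) = koszul Y X Z x := by
  rw [leviCivitaFun, dif_pos hY]
  have := TensorialAt.mkHom₂_apply (I := I) (F := E) (F' := E) (Φ := fun X Z => koszul Y X Z x) 
        (fun _ hZ => koszul_tensorial_left hY hZ) (fun _ hX => koszul_tensorial_right hY hX) hX hZ
  rw [← this]
  exact InnerProductSpace.toDual_symm_apply (𝕜 := ℝ) (E := TangentSpace I x)

lemma ext_extend {A B : TangentSpace I x →L[ℝ] TangentSpace I x}
    (h : ∀ X Z : Π x : M, TangentSpace I x, MDiffAt (T% X) x → MDiffAt (T% Z) x →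
      inner ℝ (A (X x)) (Z x) = inner ℝ (B (X x)) (Z x)) : A = B := by
  ext1 v
  refine ext_inner_right ℝ fun w => ?_
  simpa using h (FiberBundle.extend E v) (FiberBundle.extend E w)
    (FiberBundle.mdifferentiableAt_extend ..) (FiberBundle.mdifferentiableAt_extend ..)

variable (I M) in
/-- The Levi-Civita connection of a Riemannian manifold; `leviCivita I M Y x (X x)` is the value of
`∇_X Y` at `x`. -/
def leviCivita : CovariantDerivative I E (TangentSpace I : M → Type _) where
  toFun := leviCivitaFun
  isCovariantDerivativeOnUniv :=
    { add := by
        intro Y Y' x hY hY' _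
        refine ext_extend fun X Z hX hZ => ?_
        rw [inner_leviCivitaFun hX (mdifferentiableAt_add_section hY hY') hZ,
          add_apply, inner_add_left, inner_leviCivitaFun hX hY hZ,
          inner_leviCivitaFun hX hY' hZ]
        simp only [koszul, d_ip_add_left hY hY' hZ, d_ip_add_right hY hY' hX,
          VectorField.mlieBracket_add_left hY hY', VectorField.mlieBracket_add_right hY hY',
          Pi.add_apply, map_add, inner_add_left, inner_add_right]
        ring
      leibniz := by
        intro Y f x hY hf _
        refine ext_extend fun X Z hX hZ => ?_
        rw [inner_leviCivitaFun hX (hf.smul_section hY) hZ]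
        simp only [add_apply, smul_apply,
          ContinuousLinearMap.smulRight_apply, inner_add_left, inner_smul_left,
          RCLike.conj_to_real, inner_leviCivitaFun hX hY hZ]
        simp only [koszul, d_ip_smul_left hf hY hZ, d_ip_smul_right hf hY hX,
          VectorField.mlieBracket_smul_left hf hY, VectorField.mlieBracket_smul_right hf hY,
          Pi.smul_apply', map_smul, inner_add_left, inner_smul_left, inner_smul_right, smul_eq_mul,
          ip, RCLike.conj_to_real]
        rw [real_inner_comm (X x) (Y x)]
        ring }

/-- The Levi-Civita connection is compatible with the metric. -/
theorem leviCivita_metric (hX : MDiffAt (T% X) x) (hY : MDiffAt (T% Y) x)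
    (hZ : MDiffAt (T% Z) x) :
    d% (fun y => inner ℝ (Y y) (Z y)) x (X x) =
      inner ℝ (leviCivita I M Y x (X x)) (Z x) + inner ℝ (Y x) (leviCivita I M Z x (X x)) := by
  change d% (ip Y Z) x (X x) = inner ℝ (leviCivitaFun Y x (X x)) (Z x) +
    inner ℝ (Y x) (leviCivitaFun Z x (X x))
  rw [real_inner_comm _ (Y x), inner_leviCivitaFun hX hY hZ, inner_leviCivitaFun hX hZ hY]
  simp only [koszul]
  rw [ip_comm (X := Z) (Y := Y), VectorField.mlieBracket_swap_apply (V := Z) (W := Y)]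
  simp only [inner_neg_left]
  ring

/-- The Levi-Civita connection is torsion-free. -/
theorem leviCivita_torsion (hX : MDiffAt (T% X) x) (hY : MDiffAt (T% Y) x) :
    leviCivita I M Y x (X x) - leviCivita I M X x (Y x) = VectorField.mlieBracket I X Y x := by
  change leviCivitaFun Y x (X x) - leviCivitaFun X x (Y x) = _
  refine ext_inner_right ℝ fun w => ?_
  have hZ := FiberBundle.mdifferentiableAt_extend I E (V := (TangentSpace I : M → Type _)) w
  have key := fun (Y X : Π x : M, TangentSpace I x) hX hY =>
    inner_leviCivitaFun (x := x) (X := X) (Y := Y) hX hY hZ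
  simp only [FiberBundle.extend_apply_self] at key
  rw [inner_sub_left, key _ _ hX hY, key _ _ hY hX]
  simp only [koszul]
  rw [ip_comm (X := Y) (Y := X), VectorField.mlieBracket_swap_apply (V := Y) (W := X)]
  simp only [inner_neg_left, FiberBundle.extend_apply_self]
  ring

end LeviCivita

section PullbackConnection

variable {E : Type*} [NormedAddCommGroup E] [NormedSpace ℝ E]
  {H : Type*} [TopologicalSpace H] {I : ModelWithCorners ℝ E H}
  {M : Type*} [TopologicalSpace M] [ChartedSpace H M]
  {E' : Type*} [NormedAddCommGroup E'] [NormedSpace ℝ E']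
  {H' : Type*} [TopologicalSpace H'] {J : ModelWithCorners ℝ E' H'}
  {N : Type*} [TopologicalSpace N] [ChartedSpace H' N] [IsManifold J ∞ N]

variable (I) in
/-- The pullback connection `∇^F` on the bundle `F⁻¹(TN)`, for a connection `cov` on `TN`.
A section of this bundle is a vector field `s` along `F`, and `pullbackCov I cov F s x v` is
`(∇^F_v s)(x)`. It is computed in the trivialization `e` of `TN` centred at `F x`: derivative of the
coordinates of `s`, plus the derivative in the direction `F_* v` of the vector field which is
constant in this trivialization and equal to `s x` at `F x`. -/
def pullbackCov (cov : CovariantDerivative J E' (TangentSpace J : N → Type _)) (F : M → N)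
    (s : Π x : M, TangentSpace J (F x)) (x : M) :
    TangentSpace I x →L[ℝ] TangentSpace J (F x) :=
  let e := trivializationAt E' (TangentSpace J : N → Type _) (F x)
  (e.symmL ℝ (F x)) ∘L (mvfderiv I (fun y => (e ⟨F y, s y⟩).2) x)
    + (cov (FiberBundle.extend E' (s x)) (F x)) ∘L (mfderiv I J F x)

variable {cov : CovariantDerivative J E' (TangentSpace J : N → Type _)} {F : M → N}

lemma cov_sum {ι : Type*} (t : Finset ι) {f : ι → N → ℝ} {σ : ι → Π q : N, TangentSpace J q}
    {q : N} (hf : ∀ i, MDiffAt (f i) q) (hσ : ∀ i, MDiffAt (T% (σ i)) q)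
    (v : TangentSpace J q) :
    MDiffAt (T% (∑ i ∈ t, f i • σ i)) q ∧ cov (∑ i ∈ t, f i • σ i) q v =
      ∑ i ∈ t, (f i q • cov (σ i) q v + d% (f i) q v • σ i q) := by
  classical
  induction t using Finset.induction_on with
  | empty =>
    refine ⟨by simpa [zeroSection] using! mdifferentiableAt_zeroSection ℝ (TangentSpace J : N → Type _), ?_⟩
    simp
  | insert i t hi ih =>
    rw [Finset.sum_insert hi, Finset.sum_insert hi]
    have h1 := (hf i).smul_section (hσ i)
    refine ⟨mdifferentiableAt_add_section h1 ih.1, ?_⟩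
    rw [cov.isCovariantDerivativeOnUniv.add h1 ih.1,
      cov.isCovariantDerivativeOnUniv.leibniz (hσ i) (hf i)]
    simp [ih.2]

/-- In the trivialization at `x`, the vector field `extend E' v` is constant. -/
lemma extend_eq {q₀ p : N} (v : TangentSpace J q₀)
    (hp : p ∈ (trivializationAt E' (TangentSpace J : N → Type _) q₀).baseSet) :
    FiberBundle.extend E' v p = (trivializationAt E' (TangentSpace J : N → Type _) q₀).symmL ℝ p
      ((trivializationAt E' (TangentSpace J : N → Type _) q₀) ⟨q₀, v⟩).2 := by
  rw [Trivialization.symmL_apply _ hp]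
  rfl

lemma cov_coord [FiniteDimensional ℝ E'] {Z : Π q : N, TangentSpace J q} {q : N}
    (hZ : MDiffAt (T% Z) q) (v : TangentSpace J q) :
    cov Z q v =
      (trivializationAt E' (TangentSpace J : N → Type _) q).symmL ℝ q
        (d% (fun p => (trivializationAt E' (TangentSpace J : N → Type _) q ⟨p, Z p⟩).2) q v) +
      cov (FiberBundle.extend E' (Z q)) q v := by
  classical
  let e := trivializationAt E' (TangentSpace J : N → Type _) q
  let b := Module.finBasis ℝ E'
  have hq : q ∈ e.baseSet := FiberBundle.mem_baseSet_trivializationAt' q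
  let ζ : N → E' := fun p => (e ⟨p, Z p⟩).2
  let l : Fin (Module.finrank ℝ E') → E' →L[ℝ] ℝ := fun i =>
    LinearMap.toContinuousLinearMap (b.coord i)
  have hl : ∀ w : E', ∑ i, l i w • b i = w := fun w => b.sum_repr w
  let σ : Fin (Module.finrank ℝ E') → Π p : N, TangentSpace J p := fun i =>
    FiberBundle.extend E' (e.symmL ℝ q (b i))
  have hσ : ∀ i, MDiffAt (T% (σ i)) q := fun i => FiberBundle.mdifferentiableAt_extend ..
  have hσ' : ∀ i, ∀ p ∈ e.baseSet, σ i p = e.symmL ℝ p (b i) := by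
    intro i p hp
    change FiberBundle.extend E' (e.symmL ℝ q (b i)) p = _
    rw [extend_eq _ hp, Trivialization.symmL_apply _ hq, e.apply_mk_symm hq]
  have hζ : MDiffAt ζ q := (mdifferentiableAt_section J (E := (TangentSpace J : N → Type _)) Z).1 hZ
  have hf : ∀ i, MDiffAt (fun p => l i (ζ p)) q := fun i =>
    (((l i).differentiableAt).mdifferentiableAt).comp q hζ
  have hdf : ∀ i, d% (fun p => l i (ζ p)) q v = l i (d% ζ q v) := by
    intro i
    have := mfderiv_comp q (((l i).differentiableAt (x := ζ q)).mdifferentiableAt) hζ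
    have h2 := congrArg (fun T => T v) this
    simp only [mfderiv_eq_fderiv, ContinuousLinearMap.fderiv] at h2
    exact h2
  have h1 := cov_sum (cov := cov) Finset.univ hf hσ v
  have h2 := cov_sum (cov := cov) Finset.univ
    (f := fun i _ => l i (ζ q)) (fun i => mdifferentiableAt_const) hσ v
  have e1 : ∀ᶠ p in nhds q, Z p = (∑ i, (fun p => l i (ζ p)) • σ i) p := by
    filter_upwards [e.open_baseSet.mem_nhds hq] with p hp
    simp only [Finset.sum_apply, Pi.smul_apply', hσ' _ p hp, ← map_smul, ← map_sum]
    rw [hl, Trivialization.symmL_apply _ hp, e.symm_apply_apply_mk hp]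
  have e2 : ∀ᶠ p in nhds q,
      FiberBundle.extend E' (Z q) p = (∑ i, (fun _ : N => l i (ζ q)) • σ i) p := by
    filter_upwards [e.open_baseSet.mem_nhds hq] with p hp
    simp only [Finset.sum_apply, Pi.smul_apply', hσ' _ p hp, ← map_smul, ← map_sum]
    rw [hl, extend_eq _ hp]
  rw [cov.isCovariantDerivativeOnUniv.congr_of_eventuallyEq hZ h1.1 Filter.univ_mem e1, h1.2,
    cov.isCovariantDerivativeOnUniv.congr_of_eventuallyEq
      (FiberBundle.mdifferentiableAt_extend ..) h2.1 Filter.univ_mem e2, h2.2]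
  have e4 : ∑ i, l i (d% ζ q v) • σ i q = e.symmL ℝ q (d% ζ q v) := by
    simp only [hσ' _ q hq, ← map_smul, ← map_sum, hl]
  simp only [hdf, mvfderiv_const, zero_apply, zero_smul, add_zero, Finset.sum_add_distrib, e4]
  rw [add_comm]

/-- The pullback connection satisfies `∇^F_v (Z ∘ F) = ∇_{F_* v} Z`. -/
theorem pullbackCov_comp [FiniteDimensional ℝ E'] {Z : Π q : N, TangentSpace J q} {x : M}
    (hF : MDiffAt F x) (hZ : MDiffAt (T% Z) (F x)) (v : TangentSpace I x) :
    pullbackCov I cov F (fun y => Z (F y)) x v = cov Z (F x) (mfderiv I J F x v) := by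
  rw [cov_coord hZ]
  have hζ := (mdifferentiableAt_section J (E := (TangentSpace J : N → Type _)) Z).1 hZ
  have := congrArg (fun T => T v) (mfderiv_comp x hζ hF)
  simp only [pullbackCov, add_apply, ContinuousLinearMap.comp_apply]
  congr 2

lemma mdiff_coord {s : Π x : M, TangentSpace J (F x)} {x : M}
    (hs : MDifferentiableAt I J.tangent (fun y => (⟨F y, s y⟩ : TangentBundle J N)) x) :
    MDiffAt F x ∧
      MDiffAt (fun y => (trivializationAt E' (TangentSpace J : N → Type _) (F x) ⟨F y, s y⟩).2) x :=
  (mdifferentiableAt_totalSpace J (E := (TangentSpace J : N → Type _)) _).1 hs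

/-- The pullback connection is additive. -/
theorem pullbackCov_add {s t : Π x : M, TangentSpace J (F x)} {x : M}
    (hs : MDifferentiableAt I J.tangent (fun y => (⟨F y, s y⟩ : TangentBundle J N)) x)
    (ht : MDifferentiableAt I J.tangent (fun y => (⟨F y, t y⟩ : TangentBundle J N)) x) :
    pullbackCov I cov F (fun y => s y + t y) x =
      pullbackCov I cov F s x + pullbackCov I cov F t x := by
  obtain ⟨hF, hs⟩ := mdiff_coord hs
  have ht := (mdiff_coord ht).2
  let e := trivializationAt E' (TangentSpace J : N → Type _) (F x)
  have hx : F x ∈ e.baseSet := FiberBundle.mem_baseSet_trivializationAt' (F x)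
  have e1 : (fun y => (e ⟨F y, s y + t y⟩).2) =ᶠ[nhds x]
      (fun y => (e ⟨F y, s y⟩).2) + (fun y => (e ⟨F y, t y⟩).2) := by
    filter_upwards [hF.continuousAt (e.open_baseSet.mem_nhds hx)] with y hy
    exact (e.linear ℝ hy).map_add _ _
  have e2 : ∀ᶠ p in nhds (F x), FiberBundle.extend E' (s x + t x) p =
      (FiberBundle.extend E' (s x) + FiberBundle.extend E' (t x)) p := by
    filter_upwards [e.open_baseSet.mem_nhds hx] with p hp
    rw [Pi.add_apply, extend_eq _ hp, extend_eq _ hp, extend_eq _ hp, (e.linear ℝ hx).map_add,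
      map_add]
  have e3 : mvfderiv I (fun y => (e ⟨F y, s y + t y⟩).2) x =
      mvfderiv I (fun y => (e ⟨F y, s y⟩).2) x + mvfderiv I (fun y => (e ⟨F y, t y⟩).2) x := by
    rw [← mvfderiv_add hs ht]
    exact e1.mfderiv_eq
  simp only [pullbackCov]
  rw [cov.isCovariantDerivativeOnUniv.congr_of_eventuallyEq
    (FiberBundle.mdifferentiableAt_extend ..)
    (mdifferentiableAt_add_section (FiberBundle.mdifferentiableAt_extend ..)
      (FiberBundle.mdifferentiableAt_extend ..)) Filter.univ_mem e2,
    cov.isCovariantDerivativeOnUniv.add (FiberBundle.mdifferentiableAt_extend ..)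
    (FiberBundle.mdifferentiableAt_extend ..), e3]
  simp only [ContinuousLinearMap.comp_add, ContinuousLinearMap.add_comp]
  abel

/-- The pullback connection satisfies the Leibniz rule. -/
theorem pullbackCov_smul {s : Π x : M, TangentSpace J (F x)} {f : M → ℝ} {x : M}
    (hf : MDiffAt f x)
    (hs : MDifferentiableAt I J.tangent (fun y => (⟨F y, s y⟩ : TangentBundle J N)) x)
    (v : TangentSpace I x) :
    pullbackCov I cov F (fun y => f y • s y) x v =
      f x • pullbackCov I cov F s x v + d% f x v • s x := by
  obtain ⟨hF, hs⟩ := mdiff_coord hs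
  let e := trivializationAt E' (TangentSpace J : N → Type _) (F x)
  have hx : F x ∈ e.baseSet := FiberBundle.mem_baseSet_trivializationAt' (F x)
  have e1 : (fun y => (e ⟨F y, f y • s y⟩).2) =ᶠ[nhds x] f • (fun y => (e ⟨F y, s y⟩).2) := by
    filter_upwards [hF.continuousAt (e.open_baseSet.mem_nhds hx)] with y hy
    exact (e.linear ℝ hy).map_smul _ _
  have e2 : ∀ᶠ p in nhds (F x), FiberBundle.extend E' (f x • s x) p =
      ((fun _ : N => f x) • FiberBundle.extend E' (s x)) p := by
    filter_upwards [e.open_baseSet.mem_nhds hx] with p hp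
    rw [Pi.smul_apply', extend_eq _ hp, extend_eq _ hp, (e.linear ℝ hx).map_smul, map_smul]
  have e3 : mvfderiv I (fun y => (e ⟨F y, f y • s y⟩).2) x v =
      f x • mvfderiv I (fun y => (e ⟨F y, s y⟩).2) x v
        + mvfderiv I f x v • (e ⟨F x, s x⟩).2 := by
    have h := mvfderiv_smul hf hs
    have h' : mvfderiv I (fun y => (e ⟨F y, f y • s y⟩).2) x =
      mvfderiv I (f • (fun y => (e ⟨F y, s y⟩).2)) x := e1.mfderiv_eq
    rw [h', h]
    simp [e]
  simp only [pullbackCov, add_apply, ContinuousLinearMap.comp_apply]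
  rw [cov.isCovariantDerivativeOnUniv.congr_of_eventuallyEq
    (FiberBundle.mdifferentiableAt_extend ..)
    (mdifferentiableAt_const.smul_section (FiberBundle.mdifferentiableAt_extend ..))
    Filter.univ_mem e2, cov.isCovariantDerivativeOnUniv.leibniz (FiberBundle.mdifferentiableAt_extend ..)
    mdifferentiableAt_const, e3]
  have e4 : e.symmL ℝ (F x) (e ⟨F x, s x⟩).2 = s x := by
    rw [Trivialization.symmL_apply _ hx, e.symm_apply_apply_mk hx]
  change e.symmL ℝ (F x) _ + _ = _ • (e.symmL ℝ (F x) _ + _) + _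
  simp only [map_add, map_smul, e4, mvfderiv_const, add_apply, smul_apply,
    ContinuousLinearMap.smulRight_apply, zero_apply, zero_smul, add_zero, smul_add]
  abel

end PullbackConnection

section AlmostContact

variable {E : Type*} [NormedAddCommGroup E] [NormedSpace ℝ E]
  {H : Type*} [TopologicalSpace H] {I : ModelWithCorners ℝ E H}
  {M : Type*} [TopologicalSpace M] [ChartedSpace H M] [IsManifold I ∞ M]

/-- The exterior derivative of a one-form, evaluated on two vector fields:
`2 dη(X, Y) = X η(Y) - Y η(X) - η([X, Y])`. -/
def extDerivOne (η : Π x : M, TangentSpace I x →L[ℝ] ℝ) (X Y : Π x : M, TangentSpace I x)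
    (x : M) : ℝ :=
  (1 / 2 : ℝ) * (d% (fun y => η y (Y y)) x (X x) - d% (fun y => η y (X y)) x (Y x)
    - η x (VectorField.mlieBracket I X Y x))

/-- The exterior derivative of a two-form, evaluated on three vector fields:
`3 dΦ(X, Y, Z)` is the cyclic sum of `X Φ(Y, Z) - Φ([X, Y], Z)`. -/
def extDerivTwo (Φ : Π x : M, TangentSpace I x → TangentSpace I x → ℝ)
    (X Y Z : Π x : M, TangentSpace I x) (x : M) : ℝ :=
  (1 / 3 : ℝ) * (d% (fun y => Φ y (Y y) (Z y)) x (X x) + d% (fun y => Φ y (Z y) (X y)) x (Y x)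
    + d% (fun y => Φ y (X y) (Y y)) x (Z x)
    - Φ x (VectorField.mlieBracket I X Y x) (Z x) - Φ x (VectorField.mlieBracket I Y Z x) (X x)
    - Φ x (VectorField.mlieBracket I Z X x) (Y x))

/-- The Nijenhuis tensor `[φ, φ](X, Y) = φ²[X, Y] + [φX, φY] - φ[φX, Y] - φ[X, φY]`. -/
def nijenhuis (φ : Π x : M, TangentSpace I x →L[ℝ] TangentSpace I x)
    (X Y : Π x : M, TangentSpace I x) (x : M) : TangentSpace I x :=
  φ x (φ x (VectorField.mlieBracket I X Y x))
    + VectorField.mlieBracket I (fun y => φ y (X y)) (fun y => φ y (Y y)) x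
    - φ x (VectorField.mlieBracket I (fun y => φ y (X y)) Y x)
    - φ x (VectorField.mlieBracket I X (fun y => φ y (Y y)) x)

variable [RiemannianBundle (fun x : M => TangentSpace I x)]

variable (I M) in
/-- An almost contact metric structure `(φ, ξ, η)` on the Riemannian manifold `M`. -/
structure AlmostContactMetricStructure where
  /-- the tensor field `φ` of type `(1, 1)` -/
  phi : Π x : M, TangentSpace I x →L[ℝ] TangentSpace I x
  /-- the characteristic vector field -/
  xi : Π x : M, TangentSpace I x
  /-- the one-form `η` -/
  eta : Π x : M, TangentSpace I x →L[ℝ] ℝ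
  contMDiff_phi : ContMDiff I (I.prod 𝓘(ℝ, E →L[ℝ] E)) ∞
    (fun x => TotalSpace.mk' (E →L[ℝ] E)
      (E := fun x : M => TangentSpace I x →L[ℝ] TangentSpace I x) x (phi x))
  contMDiff_xi : ContMDiff I I.tangent ∞ (T% xi)
  contMDiff_eta : ContMDiff I (I.prod 𝓘(ℝ, E →L[ℝ] ℝ)) ∞
    (fun x => TotalSpace.mk' (E →L[ℝ] ℝ)
      (E := fun x : M => TangentSpace I x →L[ℝ] Bundle.Trivial M ℝ x) x (eta x))
  phi_phi : ∀ (x : M) (v : TangentSpace I x), phi x (phi x v) = -v + eta x v • xi x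
  phi_xi : ∀ x : M, phi x (xi x) = 0
  eta_phi : ∀ (x : M) (v : TangentSpace I x), eta x (phi x v) = 0
  eta_xi : ∀ x : M, eta x (xi x) = 1
  inner_phi_phi : ∀ (x : M) (v w : TangentSpace I x),
    inner ℝ (phi x v) (phi x w) = inner ℝ v w - eta x v * eta x w
  eta_eq_inner : ∀ (x : M) (v : TangentSpace I x), eta x v = inner ℝ v (xi x)

namespace AlmostContactMetricStructure

/-- The fundamental two-form `Φ(v, w) = g(v, φ w)`. -/
def fundamentalForm (S : AlmostContactMetricStructure I M) (x : M) (v w : TangentSpace I x) : ℝ :=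
  inner ℝ v (S.phi x w)

/-- The structure is cosymplectic: it is normal, and both `η` and `Φ` are closed. -/
structure IsCosymplectic (S : AlmostContactMetricStructure I M) : Prop where
  normal : ∀ X Y : Π x : M, TangentSpace I x,
    ContMDiff I I.tangent ∞ (T% X) → ContMDiff I I.tangent ∞ (T% Y) → ∀ x : M,
    nijenhuis S.phi X Y x + (2 * extDerivOne S.eta X Y x) • S.xi x = 0
  closed_eta : ∀ X Y : Π x : M, TangentSpace I x,
    ContMDiff I I.tangent ∞ (T% X) → ContMDiff I I.tangent ∞ (T% Y) → ∀ x : M,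
    extDerivOne S.eta X Y x = 0
  closed_fundamentalForm : ∀ X Y Z : Π x : M, TangentSpace I x,
    ContMDiff I I.tangent ∞ (T% X) → ContMDiff I I.tangent ∞ (T% Y) →
    ContMDiff I I.tangent ∞ (T% Z) → ∀ x : M,
    extDerivTwo S.fundamentalForm X Y Z x = 0

end AlmostContactMetricStructure

end AlmostContact

section Submersion

variable {E : Type*} [NormedAddCommGroup E] [NormedSpace ℝ E] [FiniteDimensional ℝ E]
  {H : Type*} [TopologicalSpace H] (I : ModelWithCorners ℝ E H)
  {M : Type*} [TopologicalSpace M] [ChartedSpace H M] [IsManifold I ∞ M]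
  [RiemannianBundle (fun x : M => TangentSpace I x)]
  [IsContMDiffRiemannianBundle I ∞ E (fun x : M => TangentSpace I x)]
  {E' : Type*} [NormedAddCommGroup E'] [NormedSpace ℝ E'] [FiniteDimensional ℝ E']
  {H' : Type*} [TopologicalSpace H'] (J : ModelWithCorners ℝ E' H')
  {N : Type*} [TopologicalSpace N] [ChartedSpace H' N] [IsManifold J ∞ N]
  [RiemannianBundle (fun q : N => TangentSpace J q)]
  [IsContMDiffRiemannianBundle J ∞ E' (fun q : N => TangentSpace J q)]

/-- The vertical space `ker F_*` at `x`. The horizontal space is `(vertical I J F x)ᗮ`. -/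
def vertical (F : M → N) (x : M) : Submodule ℝ (TangentSpace I x) :=
  LinearMap.ker (mfderiv I J F x : TangentSpace I x →ₗ[ℝ] TangentSpace J (F x))

/-- The vertical part of a vector field. -/
def verPart (F : M → N) (X : Π x : M, TangentSpace I x) (x : M) : TangentSpace I x :=
  (vertical I J F x).starProjection (X x)

/-- The horizontal part of a vector field. -/
def horPart (F : M → N) (X : Π x : M, TangentSpace I x) (x : M) : TangentSpace I x :=
  (vertical I J F x)ᗮ.starProjection (X x)

/-- A smooth section of `ker F_*`. -/
def IsVerticalField (F : M → N) (V : Π x : M, TangentSpace I x) : Prop :=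
  ContMDiff I I.tangent ∞ (T% V) ∧ ∀ x, V x ∈ vertical I J F x

/-- A smooth section of `(ker F_*)ᗮ`. -/
def IsHorizontalField (F : M → N) (X : Π x : M, TangentSpace I x) : Prop :=
  ContMDiff I I.tangent ∞ (T% X) ∧ ∀ x, X x ∈ (vertical I J F x)ᗮ

/-- The covariant derivative `∇_X Y` for the Levi-Civita connection of `M`. -/
def nabla (X Y : Π x : M, TangentSpace I x) (x : M) : TangentSpace I x :=
  leviCivita I M Y x (X x)

/-- O'Neill's tensor `T_X Y = H ∇_{V X} (V Y) + V ∇_{V X} (H Y)`. -/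
def tensorT (F : M → N) (X Y : Π x : M, TangentSpace I x) (x : M) : TangentSpace I x :=
  horPart I J F (nabla I (verPart I J F X) (verPart I J F Y)) x
    + verPart I J F (nabla I (verPart I J F X) (horPart I J F Y)) x

/-- O'Neill's tensor `A_X Y = V ∇_{H X} (H Y) + H ∇_{H X} (V Y)`. -/
def tensorA (F : M → N) (X Y : Π x : M, TangentSpace I x) (x : M) : TangentSpace I x :=
  verPart I J F (nabla I (horPart I J F X) (horPart I J F Y)) x
    + horPart I J F (nabla I (horPart I J F X) (verPart I J F Y)) x

/-- The second fundamental form `(∇F_*)(X, Y) = ∇^F_X (F_* Y) - F_* (∇_X Y)` of a map. -/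
def secondFundamentalForm (F : M → N) (X Y : Π x : M, TangentSpace I x) (x : M) :
    TangentSpace J (F x) :=
  pullbackCov I (leviCivita J N) F (fun y => mfderiv I J F y (Y y)) x (X x)
    - mfderiv I J F x (nabla I X Y x)

/-- `F` is a totally geodesic map: `∇F_* = 0`. -/
def IsTotallyGeodesic (F : M → N) : Prop :=
  ∀ X Y : Π x : M, TangentSpace I x,
    ContMDiff I I.tangent ∞ (T% X) → ContMDiff I I.tangent ∞ (T% Y) →
    ∀ x, secondFundamentalForm I J F X Y x = 0

/-- `F` is a Riemannian submersion: a smooth surjective map, of maximal rank, whose differential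
preserves the lengths of horizontal vectors. -/
structure IsRiemannianSubmersion (F : M → N) : Prop where
  contMDiff : ContMDiff I J ∞ F
  surjective : Function.Surjective F
  surjective_mfderiv : ∀ x : M, Function.Surjective (mfderiv I J F x)
  norm_mfderiv : ∀ (x : M), ∀ v ∈ (vertical I J F x)ᗮ, ‖mfderiv I J F x v‖ = ‖v‖

variable {I} in
/-- `F` is anti-invariant: `φ (ker F_*) ⊆ (ker F_*)ᗮ`. -/
def IsAntiInvariant (S : AlmostContactMetricStructure I M) (F : M → N) : Prop :=
  ∀ x : M, (vertical I J F x).map (S.phi x : TangentSpace I x →ₗ[ℝ] TangentSpace I x) ≤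
    (vertical I J F x)ᗮ

end Submersion

end CosymplecticSubmersion

end

open CosymplecticSubmersion

namespace CosymplecticSubmersion

section SmoothFields

variable {E : Type*} [NormedAddCommGroup E] [NormedSpace ℝ E] [FiniteDimensional ℝ E]
  {H : Type*} [TopologicalSpace H] {I : ModelWithCorners ℝ E H}
  {M : Type*} [TopologicalSpace M] [ChartedSpace H M] [IsManifold I ∞ M]

lemma mdifferentiableAt_of_contMDiff {X : Π x : M, TangentSpace I x}
    (hX : ContMDiff I I.tangent ∞ (T% X)) (x : M) : MDiffAt (T% X) x :=
  (hX x).mdifferentiableAt (by simp)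

/-- Every tangent vector is the value of a smooth vector field. -/
theorem exists_contMDiff_vectorField_eq [T2Space M] (x : M) (v : TangentSpace I x) :
    ∃ X : Π x : M, TangentSpace I x, ContMDiff I I.tangent ∞ (T% X) ∧ X x = v := by
  obtain ⟨s, hs, h⟩ := FiberBundle.exists_contMDiffOn_extend (I := I) (k := ∞) (F := E) v
  obtain ⟨f, -, hf⟩ :=
    (SmoothBumpFunction.nhds_basis_tsupport (I := I) x).mem_iff.1 (interior_mem_nhds.2 hs)
  refine ⟨fun y => f y • FiberBundle.extend E v y, fun y => ?_, by simp⟩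
  by_cases hy : y ∈ tsupport f
  · exact f.contMDiffAt.smul_section (h.contMDiffAt (mem_interior_iff_mem_nhds.1 (hf hy)))
  · refine (contMDiffAt_zeroSection ℝ (TangentSpace I : M → Type _)).congr_of_eventuallyEq ?_
    filter_upwards [(isClosed_tsupport f).isOpen_compl.mem_nhds hy] with z hz
    simp [image_eq_zero_of_notMem_tsupport hz, zeroSection]

variable [RiemannianBundle (fun x : M => TangentSpace I x)]
  [IsContMDiffRiemannianBundle I ∞ E (fun x : M => TangentSpace I x)]

open InnerProductSpace in
/-- Gram-Schmidt orthogonalization preserves smoothness. -/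
theorem contMDiffAt_gramSchmidt {n : ℕ} {s : Fin n → Π x : M, TangentSpace I x} {x : M}
    (hs : ∀ i, ContMDiffAt I I.tangent ∞ (T% (s i)) x)
    (hli : LinearIndependent ℝ (fun i => s i x)) (i : Fin n) :
    ContMDiffAt I I.tangent ∞ (T% (fun y => gramSchmidt ℝ (fun j => s j y) i)) x := by
  induction i using WellFoundedLT.induction with
  | ind i ih =>
    have : (fun y => gramSchmidt ℝ (fun j => s j y) i) = fun y => s i y -
        ∑ j ∈ Finset.Iio i, (inner ℝ (gramSchmidt ℝ (fun j => s j y) j) (s i y) *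
          (inner ℝ (gramSchmidt ℝ (fun j => s j y) j) (gramSchmidt ℝ (fun j => s j y) j))⁻¹) •
          gramSchmidt ℝ (fun j => s j y) j := by
      funext y
      rw [gramSchmidt_def]
      congr 1
      refine Finset.sum_congr rfl fun j _ => ?_
      rw [Submodule.starProjection_singleton, real_inner_self_eq_norm_sq]
      rfl
    refine ContMDiffAt.congr_of_eventuallyEq
      ((hs i).sub_section (ContMDiffAt.sum_section fun j hj => ?_))
      (Filter.Eventually.of_forall fun y => congrArg (TotalSpace.mk y) (congrFun this y))
    have hj' := ih j (Finset.mem_Iio.1 hj)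
    refine ContMDiffAt.smul_section (ContMDiffAt.mul ?_ (ContMDiffAt.inv₀ ?_ ?_)) hj'
    · exact ContMDiffAt.inner_bundle (E := fun x : M => TangentSpace I x) (b := id) hj' (hs i)
    · exact ContMDiffAt.inner_bundle (E := fun x : M => TangentSpace I x) (b := id) hj' hj'
    · rw [inner_self_ne_zero]
      exact gramSchmidt_ne_zero j hli

open InnerProductSpace in
variable (I) in
/-- There is a smooth orthogonal frame near every point. -/
theorem exists_orthogonal_frame (x : M) :
    ∃ s : Fin (Module.finrank ℝ E) → Π x : M, TangentSpace I x,
      (∀ i, ContMDiffAt I I.tangent ∞ (T% (s i)) x) ∧ (∀ i, s i x ≠ 0) ∧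
      ∀ᶠ y in nhds x, ∀ v : TangentSpace I y,
        v = ∑ i, (inner ℝ (s i y) v * (inner ℝ (s i y) (s i y))⁻¹) • s i y := by
  let e := trivializationAt E (TangentSpace I : M → Type _) x
  let b := Module.finBasis ℝ E
  have hx : x ∈ e.baseSet := FiberBundle.mem_baseSet_trivializationAt' x
  have hf := e.isLocalFrameOn_localFrame_baseSet I ∞ b
  refine ⟨fun i y => gramSchmidt ℝ (fun j => e.localFrame b j y) i,
    contMDiffAt_gramSchmidt (fun i => hf.contMDiffAt e.open_baseSet hx i)
      (hf.linearIndependent hx), fun i => gramSchmidt_ne_zero i (hf.linearIndependent hx), ?_⟩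
  filter_upwards [e.open_baseSet.mem_nhds hx] with y hy v
  let g : Fin (Module.finrank ℝ E) → TangentSpace I y := gramSchmidt ℝ (fun j => e.localFrame b j y)
  have hsp : Submodule.span ℝ (Set.range g) = ⊤ := by
    rw [span_gramSchmidt]
    exact top_le_iff.1 (hf.generating hy)
  have horth : Pairwise fun i j => inner ℝ (g i) (g j) = 0 := gramSchmidt_pairwise_orthogonal ℝ _
  have hne : ∀ i, g i ≠ 0 := fun i => gramSchmidt_ne_zero i (hf.linearIndependent hy)
  change v = ∑ i, (inner ℝ (g i) v * (inner ℝ (g i) (g i))⁻¹) • g i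
  have hv : v ∈ Submodule.span ℝ (Set.range g) := hsp ▸ Submodule.mem_top
  obtain ⟨c, rfl⟩ := (Submodule.mem_span_range_iff_exists_fun ℝ).1 hv
  refine Finset.sum_congr rfl fun i _ => ?_
  rw [inner_sum, Finset.sum_eq_single i]
  · rw [inner_smul_right, mul_assoc, mul_inv_cancel₀ (inner_self_ne_zero.2 (hne i)), mul_one]
  · intro j _ hj
    rw [inner_smul_right, horth hj.symm, mul_zero]
  · simp

end SmoothFields

section Projections

variable {E : Type*} [NormedAddCommGroup E] [NormedSpace ℝ E] [FiniteDimensional ℝ E]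
  {H : Type*} [TopologicalSpace H] {I : ModelWithCorners ℝ E H}
  {M : Type*} [TopologicalSpace M] [ChartedSpace H M] [IsManifold I ∞ M]
  [RiemannianBundle (fun x : M => TangentSpace I x)]
  [IsContMDiffRiemannianBundle I ∞ E (fun x : M => TangentSpace I x)]
  {E' : Type*} [NormedAddCommGroup E'] [NormedSpace ℝ E'] [FiniteDimensional ℝ E']
  {H' : Type*} [TopologicalSpace H'] {J : ModelWithCorners ℝ E' H'}
  {N : Type*} [TopologicalSpace N] [ChartedSpace H' N] [IsManifold J ∞ N]
  [RiemannianBundle (fun q : N => TangentSpace J q)]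
  [IsContMDiffRiemannianBundle J ∞ E' (fun q : N => TangentSpace J q)]
  {F : M → N}

lemma mem_vertical {x : M} {v : TangentSpace I x} :
    v ∈ vertical I J F x ↔ mfderiv I J F x v = 0 := Iff.rfl

lemma verPart_add_horPart (X : Π x : M, TangentSpace I x) (x : M) :
    verPart I J F X x + horPart I J F X x = X x :=
  Submodule.starProjection_add_starProjection_orthogonal (K := vertical I J F x) (X x)

lemma verPart_mem (X : Π x : M, TangentSpace I x) (x : M) :
    verPart I J F X x ∈ vertical I J F x := Submodule.starProjection_apply_mem _ _

lemma horPart_mem (X : Π x : M, TangentSpace I x) (x : M) :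
    horPart I J F X x ∈ (vertical I J F x)ᗮ := Submodule.starProjection_apply_mem _ _

lemma mfderiv_horPart (X : Π x : M, TangentSpace I x) (x : M) :
    mfderiv I J F x (horPart I J F X x) = mfderiv I J F x (X x) := by
  conv_rhs => rw [← verPart_add_horPart (J := J) (F := F) X x]
  rw [map_add, mem_vertical.1 (verPart_mem X x), zero_add]

lemma contMDiff_mfderiv_apply (hF : ContMDiff I J ∞ F) {X : Π x : M, TangentSpace I x} {x : M}
    (hX : ContMDiffAt I I.tangent ∞ (T% X) x) :
    ContMDiffAt I J.tangent ∞
      (fun y => (⟨F y, mfderiv I J F y (X y)⟩ : TangentBundle J N)) x :=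
  ((hF.contMDiff_tangentMap (m := ∞) (by simp)) _).comp x hX

/-- The differential of a Riemannian submersion is isometric on horizontal vectors. -/
lemma IsRiemannianSubmersion.inner_mfderiv (hF : IsRiemannianSubmersion I J F) {x : M}
    {v w : TangentSpace I x} (hv : v ∈ (vertical I J F x)ᗮ) :
    inner ℝ (mfderiv I J F x v) (mfderiv I J F x w) = inner ℝ v w := by
  have key : ∀ a ∈ (vertical I J F x)ᗮ,
      inner ℝ (mfderiv I J F x v) (mfderiv I J F x a) = inner ℝ v a := by
    intro a ha
    rw [real_inner_eq_norm_add_mul_self_sub_norm_mul_self_sub_norm_mul_self_div_two,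
      real_inner_eq_norm_add_mul_self_sub_norm_mul_self_sub_norm_mul_self_div_two,
      ← map_add, hF.norm_mfderiv x v hv, hF.norm_mfderiv x a ha,
      hF.norm_mfderiv x _ (Submodule.add_mem _ hv ha)]
  obtain ⟨a, ha, b, hb, rfl⟩ := (vertical I J F x).exists_add_mem_mem_orthogonal w
  rw [map_add, mem_vertical.1 ha, zero_add, inner_add_right,
    (Submodule.mem_orthogonal' _ _).1 hv a ha, zero_add, key b hb]

/-- The horizontal part of a smooth vector field is smooth. -/
theorem IsRiemannianSubmersion.contMDiff_horPart (hF : IsRiemannianSubmersion I J F)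
    {X : Π x : M, TangentSpace I x} (hX : ContMDiff I I.tangent ∞ (T% X)) :
    ContMDiff I I.tangent ∞ (T% (horPart I J F X)) := by
  intro x
  obtain ⟨s, hs, hne, hsum⟩ := exists_orthogonal_frame I x
  have hsm : ContMDiffAt I I.tangent ∞ (T% (fun y => ∑ i,
      (inner ℝ (mfderiv I J F y (s i y)) (mfderiv I J F y (X y)) *
        (inner ℝ (s i y) (s i y))⁻¹) • s i y)) x := by
    refine ContMDiffAt.sum_section fun i _ => ?_
    refine ContMDiffAt.smul_section (ContMDiffAt.mul ?_ (ContMDiffAt.inv₀ ?_ ?_)) (hs i)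
    · exact ContMDiffAt.inner_bundle (E := fun q : N => TangentSpace J q) (b := F)
        (contMDiff_mfderiv_apply hF.contMDiff (hs i)) (contMDiff_mfderiv_apply hF.contMDiff (hX x))
    · exact ContMDiffAt.inner_bundle (E := fun x : M => TangentSpace I x) (b := id) (hs i) (hs i)
    · rw [inner_self_ne_zero]
      exact hne i
  refine hsm.congr_of_eventuallyEq ?_
  filter_upwards [hsum] with y hy
  congr 1
  rw [hy (horPart I J F X y)]
  refine Finset.sum_congr rfl fun i _ => ?_
  rw [real_inner_comm (horPart I J F X y), ← hF.inner_mfderiv (horPart_mem X y), mfderiv_horPart,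
    real_inner_comm (mfderiv I J F y (X y))]

/-- The vertical part of a smooth vector field is smooth. -/
theorem IsRiemannianSubmersion.contMDiff_verPart (hF : IsRiemannianSubmersion I J F)
    {X : Π x : M, TangentSpace I x} (hX : ContMDiff I I.tangent ∞ (T% X)) :
    ContMDiff I I.tangent ∞ (T% (verPart I J F X)) := by
  have : verPart I J F X = fun y => X y - horPart I J F X y := by
    funext y
    exact eq_sub_of_add_eq (verPart_add_horPart X y)
  rw [this]
  exact hX.sub_section (hF.contMDiff_horPart hX)

/-- Every vertical vector is the value of a smooth vertical vector field. -/
theorem IsRiemannianSubmersion.exists_isVerticalField_eq [T2Space M]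
    (hF : IsRiemannianSubmersion I J F) {x : M} {v : TangentSpace I x}
    (hv : v ∈ vertical I J F x) : ∃ V, IsVerticalField I J F V ∧ V x = v := by
  obtain ⟨X, hX, rfl⟩ := exists_contMDiff_vectorField_eq x v
  exact ⟨verPart I J F X, ⟨hF.contMDiff_verPart hX, verPart_mem X⟩,
    Submodule.starProjection_eq_self_iff.2 hv⟩

end Projections

section SecondDerivative

variable {E : Type*} [NormedAddCommGroup E] [NormedSpace ℝ E] [CompleteSpace E]
  {H : Type*} [TopologicalSpace H] {I : ModelWithCorners ℝ E H} [I.Boundaryless]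
  {M : Type*} [TopologicalSpace M] [ChartedSpace H M] [IsManifold I ∞ M]
  {G : Type*} [NormedAddCommGroup G] [NormedSpace ℝ G]

open VectorField in
/-- The derivative of a function along a vector field, computed in a chart. -/
lemma fderiv_comp_extChartAt_symm {g : M → G} {x : M} {z : E} (hz : z ∈ (extChartAt I x).target)
    (hg : MDiffAt g ((extChartAt I x).symm z)) (Z : Π x : M, TangentSpace I x) :
    fderiv ℝ (g ∘ (extChartAt I x).symm) z
        (mpullbackWithin 𝓘(ℝ, E) I (extChartAt I x).symm Z (Set.range I) z) =
      d% g ((extChartAt I x).symm z) (Z ((extChartAt I x).symm z)) := by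
  have hφ := mdifferentiableWithinAt_extChartAt_symm hz
  have h := mfderiv_comp_mfderivWithin z hg hφ (I.uniqueMDiffOn _ (by simp [I.range_eq_univ]))
  rw [I.range_eq_univ, mfderivWithin_univ, mfderiv_eq_fderiv] at h
  have h2 : (mfderivWithin 𝓘(ℝ, E) I (extChartAt I x).symm (Set.range I) z)
      (mpullbackWithin 𝓘(ℝ, E) I (extChartAt I x).symm Z (Set.range I) z) =
        Z ((extChartAt I x).symm z) :=
    (isInvertible_mfderivWithin_extChartAt_symm hz).self_apply_inverse _
  rw [I.range_eq_univ] at h2 ⊢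
  have h3 := congrArg (fun T => T
    (mpullbackWithin 𝓘(ℝ, E) I (extChartAt I x).symm Z Set.univ z)) h
  exact h3.trans (congrArg (d% g _) h2)

open VectorField in
/-- The derivative along a Lie bracket is the commutator of derivatives. -/
theorem mvfderiv_mlieBracket {f : M → G} {x : M} (hf : ContMDiffAt I 𝓘(ℝ, G) ∞ f x)
    {X Y : Π x : M, TangentSpace I x} (hX : MDiffAt (T% X) x) (hY : MDiffAt (T% Y) x) :
    d% f x (mlieBracket I X Y x) =
      d% (fun y => d% f y (Y y)) x (X x) - d% (fun y => d% f y (X y)) x (Y x) := by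
  have hx := mem_extChartAt_target (I := I) x
  have hinv : (extChartAt I x).symm (extChartAt I x x) = x := extChartAt_to_inv x
  have hfh : ContDiffAt ℝ ∞ (f ∘ (extChartAt I x).symm) (extChartAt I x x) := by
    have := (contMDiffAt_iff.1 hf).2
    rw [I.range_eq_univ] at this
    exact this.contDiffAt Filter.univ_mem
  have hd : ∀ {Z : Π x : M, TangentSpace I x}, MDiffAt (T% Z) x → DifferentiableAt ℝ
      (mpullbackWithin 𝓘(ℝ, E) I (extChartAt I x).symm Z (Set.range I)) (extChartAt I x x) := by
    intro Z hZ
    have := MDifferentiableWithinAt.differentiableWithinAt_mpullbackWithin_vectorField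
      (s := Set.univ) hZ.mdifferentiableWithinAt
    simp only [I.range_eq_univ, Set.preimage_univ, Set.inter_univ] at this ⊢
    exact differentiableWithinAt_univ.1 this
  have hev : ∀ᶠ z in nhds (extChartAt I x x), z ∈ (extChartAt I x).target ∧
      MDiffAt f ((extChartAt I x).symm z) := by
    have h1 : ∀ᶠ y in nhds x, MDiffAt f y :=
      ((contMDiffAt_iff_contMDiffAt_nhds (by simp)).1 (hf.of_le (m := 1) (by simp))).mono
        fun y hy => hy.mdifferentiableAt (by simp)
    have hc : Filter.Tendsto (extChartAt I x).symm (nhds (extChartAt I x x)) (nhds x) := by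
      have := continuousAt_extChartAt_symm (I := I) x
      rwa [ContinuousAt, hinv] at this
    exact Filter.Eventually.and ((isOpen_extChartAt_target x).mem_nhds hx) (hc.eventually h1)
  have hdd : ∀ {Z W : Π x : M, TangentSpace I x}, MDiffAt (T% Z) x →
      fderiv ℝ (fun z => fderiv ℝ (f ∘ (extChartAt I x).symm) z
        (mpullbackWithin 𝓘(ℝ, E) I (extChartAt I x).symm Z (Set.range I) z)) (extChartAt I x x)
        (mpullbackWithin 𝓘(ℝ, E) I (extChartAt I x).symm W (Set.range I) (extChartAt I x x)) =
      d% (fun y => d% f y (Z y)) x (W x) := by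
    intro Z W hZ
    have heq : (fun z => fderiv ℝ (f ∘ (extChartAt I x).symm) z
        (mpullbackWithin 𝓘(ℝ, E) I (extChartAt I x).symm Z (Set.range I) z)) =ᶠ[nhds
          (extChartAt I x x)] (fun y => d% f y (Z y)) ∘ (extChartAt I x).symm := by
      filter_upwards [hev] with z hz
      exact fderiv_comp_extChartAt_symm hz.1 hz.2 Z
    have hdiff : DifferentiableAt ℝ ((fun y => d% f y (Z y)) ∘ (extChartAt I x).symm)
        (extChartAt I x x) := by
      refine DifferentiableAt.congr_of_eventuallyEq ?_ heq.symm
      exact ((hfh.fderiv_right (m := 1) (ENat.LEInfty.out : 2 ≤ ∞)).differentiableAt (by simp)).clm_apply (hd hZ)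
    have hm : MDiffAt (fun y => d% f y (Z y)) x := by
      have h1 := (hdiff.mdifferentiableAt).comp x
        ((contMDiffAt_extChartAt (I := I) (n := 1) (x := x)).mdifferentiableAt (by simp))
      refine h1.congr_of_eventuallyEq ?_
      filter_upwards [extChartAt_source_mem_nhds (I := I) x] with y hy
      exact (congrArg (fun y => d% f y (Z y)) ((extChartAt I x).left_inv hy)).symm
    rw [heq.fderiv_eq, fderiv_comp_extChartAt_symm hx (by rwa [hinv]), hinv]
  have hL := fderiv_apply_lieBracket hfh (by simpa using ENat.LEInfty.out) (hd hY) (hd hX)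
  rw [hdd hY, hdd hX] at hL
  rw [← hL]
  have hcomp : f =ᶠ[nhds x] (f ∘ (extChartAt I x).symm) ∘ extChartAt I x := by
    filter_upwards [extChartAt_source_mem_nhds (I := I) x] with y hy
    exact (congrArg f ((extChartAt I x).left_inv hy)).symm
  have hchain := mfderiv_comp x (hfh.differentiableAt (by simp)).mdifferentiableAt
    ((contMDiffAt_extChartAt (I := I) (n := 1) (x := x)).mdifferentiableAt (by simp))
  rw [← hcomp.mfderiv_eq, mfderiv_eq_fderiv] at hchain
  refine (congrArg (fun T => T (mlieBracket I X Y x)) hchain).trans ?_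
  refine congrArg (fderiv ℝ (f ∘ (extChartAt I x).symm) (extChartAt I x x)) ?_
  refine ((isInvertible_mfderiv_extChartAt (mem_extChartAt_source x)).self_apply_inverse _).trans ?_
  rw [Set.preimage_univ, Set.univ_inter, I.range_eq_univ]
  exact congrFun (lieBracketWithin_univ (𝕜 := ℝ) (E := E)) _

end SecondDerivative

section PullbackTorsion

variable {E : Type*} [NormedAddCommGroup E] [NormedSpace ℝ E] [FiniteDimensional ℝ E]
  {H : Type*} [TopologicalSpace H] {I : ModelWithCorners ℝ E H} [I.Boundaryless]
  {M : Type*} [TopologicalSpace M] [ChartedSpace H M] [IsManifold I ∞ M]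
  {E' : Type*} [NormedAddCommGroup E'] [NormedSpace ℝ E'] [FiniteDimensional ℝ E']
  {H' : Type*} [TopologicalSpace H'] {J : ModelWithCorners ℝ E' H'} [J.Boundaryless]
  {N : Type*} [TopologicalSpace N] [ChartedSpace H' N] [IsManifold J ∞ N]
  [RiemannianBundle (fun q : N => TangentSpace J q)]
  [IsContMDiffRiemannianBundle J ∞ E' (fun q : N => TangentSpace J q)]
  {F : M → N} {x : M}

lemma trivializationAt_snd_eq {q p : N} (hp : p ∈ (chartAt H' q).source) (w : TangentSpace J p) :
    (trivializationAt E' (TangentSpace J : N → Type _) q ⟨p, w⟩).2 =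
      d% (extChartAt J q) p w := by
  have hp' : p ∈ (trivializationAt E' (TangentSpace J : N → Type _) q).baseSet := by simpa using hp
  have := congrArg (fun T => T w) (TangentBundle.continuousLinearMapAt_trivializationAt (I := J) hp)
  refine Eq.trans ?_ this
  rw [Trivialization.continuousLinearMapAt_apply, Trivialization.linearMapAt_apply, if_pos hp']

lemma trivializationAt_snd_injective (q : N) {v w : TangentSpace J q}
    (h : (trivializationAt E' (TangentSpace J : N → Type _) q ⟨q, v⟩).2 =
      (trivializationAt E' (TangentSpace J : N → Type _) q ⟨q, w⟩).2) : v = w := by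
  let e := trivializationAt E' (TangentSpace J : N → Type _) q
  have hq : q ∈ e.baseSet := FiberBundle.mem_baseSet_trivializationAt' q
  rw [← e.symm_apply_apply_mk hq v, ← e.symm_apply_apply_mk hq w]
  exact congrArg (e.symm q) h

/-- The vector fields that are constant in a tangent trivialization commute at its centre. -/
lemma mlieBracket_extend (q : N) (v w : TangentSpace J q) :
    VectorField.mlieBracket J (FiberBundle.extend E' v) (FiberBundle.extend E' w) q = 0 := by
  let e := trivializationAt E' (TangentSpace J : N → Type _) q
  have hq : q ∈ (chartAt H' q).source := mem_chart_source H' q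
  have hconst : ∀ u : TangentSpace J q, (fun p => d% (extChartAt J q) p (FiberBundle.extend E' u p))
      =ᶠ[nhds q] fun _ => (e ⟨q, u⟩).2 := by
    intro u
    filter_upwards [(chartAt H' q).open_source.mem_nhds hq] with p hp
    have hp' : p ∈ e.baseSet := by simpa [e] using hp
    rw [← trivializationAt_snd_eq hp, extend_eq _ hp', Trivialization.symmL_apply _ hp']
    change (e ⟨p, _⟩).2 = _
    rw [e.apply_mk_symm hp']
  have hzero : ∀ u a : TangentSpace J q,
      d% (fun p => d% (extChartAt J q) p (FiberBundle.extend E' u p)) q a = 0 := by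
    intro u a
    have h1 : d% (fun p => d% (extChartAt J q) p (FiberBundle.extend E' u p)) q =
        d% (fun _ : N => (e ⟨q, u⟩).2) q := (hconst u).mfderiv_eq
    rw [h1, mvfderiv_const]
    rfl
  apply trivializationAt_snd_injective q
  rw [trivializationAt_snd_eq hq, trivializationAt_snd_eq hq,
    mvfderiv_mlieBracket contMDiffAt_extChartAt (FiberBundle.mdifferentiableAt_extend ..)
      (FiberBundle.mdifferentiableAt_extend ..), hzero, hzero, map_zero, sub_zero]

/-- The pullback of the Levi-Civita connection has no torsion. -/
theorem pullbackCov_torsion (hF : ContMDiff I J ∞ F) {X Y : Π x : M, TangentSpace I x}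
    (hX : MDiffAt (T% X) x) (hY : MDiffAt (T% Y) x) :
    pullbackCov I (leviCivita J N) F (fun y => mfderiv I J F y (Y y)) x (X x) -
      pullbackCov I (leviCivita J N) F (fun y => mfderiv I J F y (X y)) x (Y x) =
    mfderiv I J F x (VectorField.mlieBracket I X Y x) := by
  let e := trivializationAt E' (TangentSpace J : N → Type _) (F x)
  have hq : F x ∈ (chartAt H' (F x)).source := mem_chart_source H' (F x)
  have hFd : ∀ y, MDiffAt F y := fun y => (hF y).mdifferentiableAt (by simp)
  have hchain : ∀ y, F y ∈ (chartAt H' (F x)).source → ∀ w : TangentSpace I y,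
      (e ⟨F y, mfderiv I J F y w⟩).2 = d% (extChartAt J (F x) ∘ F) y w := by
    intro y hy w
    rw [trivializationAt_snd_eq hy]
    exact (congrArg (fun T => T w)
      (mfderiv_comp y (mdifferentiableAt_extChartAt (I := J) hy) (hFd y))).symm
  have hev : ∀ Z : Π x : M, TangentSpace I x,
      d% (fun y => (e ⟨F y, mfderiv I J F y (Z y)⟩).2) x =
        d% (fun y => d% (extChartAt J (F x) ∘ F) y (Z y)) x := by
    intro Z
    refine Filter.EventuallyEq.mfderiv_eq ?_
    filter_upwards [(hFd x).continuousAt ((chartAt H' (F x)).open_source.mem_nhds hq)] with y hy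
    exact hchain y hy _
  have hbr := mvfderiv_mlieBracket (f := extChartAt J (F x) ∘ F)
    (contMDiffAt_extChartAt.comp x (hF x)) hX hY
  have htor := leviCivita_torsion (I := J)
    (FiberBundle.mdifferentiableAt_extend J E' (mfderiv I J F x (X x)))
    (FiberBundle.mdifferentiableAt_extend J E' (mfderiv I J F x (Y x)))
  rw [mlieBracket_extend, FiberBundle.extend_apply_self, FiberBundle.extend_apply_self] at htor
  have hsymm : e.symmL ℝ (F x) (d% (extChartAt J (F x) ∘ F) x (VectorField.mlieBracket I X Y x)) =
      mfderiv I J F x (VectorField.mlieBracket I X Y x) := by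
    have hx : F x ∈ e.baseSet := FiberBundle.mem_baseSet_trivializationAt' (F x)
    rw [← hchain x hq, Trivialization.symmL_apply _ hx, e.symm_apply_apply_mk hx]
  rw [← hsymm, hbr, map_sub, ← hev, ← hev]
  simp only [pullbackCov, add_apply, ContinuousLinearMap.comp_apply]
  rw [add_sub_add_comm, htor, add_zero]

end PullbackTorsion

section PullbackMetric

variable {E : Type*} [NormedAddCommGroup E] [NormedSpace ℝ E]
  {H : Type*} [TopologicalSpace H] {I : ModelWithCorners ℝ E H}
  {M : Type*} [TopologicalSpace M] [ChartedSpace H M]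
  {E' : Type*} [NormedAddCommGroup E'] [NormedSpace ℝ E'] [FiniteDimensional ℝ E']
  {H' : Type*} [TopologicalSpace H'] {J : ModelWithCorners ℝ E' H'}
  {N : Type*} [TopologicalSpace N] [ChartedSpace H' N] [IsManifold J ∞ N]
  {F : M → N} {x : M}

lemma pullbackCov_congr {cov : CovariantDerivative J E' (TangentSpace J : N → Type _)}
    {s t : Π x : M, TangentSpace J (F x)} (h : ∀ᶠ y in nhds x, s y = t y) :
    pullbackCov I cov F s x = pullbackCov I cov F t x := by
  have h1 : mvfderiv I (fun y =>
        (trivializationAt E' (TangentSpace J : N → Type _) (F x) ⟨F y, s y⟩).2) x =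
      mvfderiv I (fun y =>
        (trivializationAt E' (TangentSpace J : N → Type _) (F x) ⟨F y, t y⟩).2) x :=
    Filter.EventuallyEq.mfderiv_eq (h.mono fun y hy => by simp only [hy])
  have h2 : s x = t x := h.self_of_nhds
  simp only [pullbackCov]
  rw [h2]
  congr 2

lemma pullbackCov_zero {cov : CovariantDerivative J E' (TangentSpace J : N → Type _)}
    (hF : MDiffAt F x) (v : TangentSpace I x) :
    pullbackCov I cov F (fun _ => 0) x v = 0 := by
  have h := pullbackCov_comp (cov := cov) (F := F) (Z := 0) hF
    (mdifferentiableAt_zeroSection ℝ (TangentSpace J : N → Type _)) v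
  rw [cov.zero] at h
  exact h

lemma mdifferentiableAt_add_along {s t : Π x : M, TangentSpace J (F x)}
    (hs : MDifferentiableAt I J.tangent (fun y => (⟨F y, s y⟩ : TangentBundle J N)) x)
    (ht : MDifferentiableAt I J.tangent (fun y => (⟨F y, t y⟩ : TangentBundle J N)) x) :
    MDifferentiableAt I J.tangent (fun y => (⟨F y, s y + t y⟩ : TangentBundle J N)) x := by
  obtain ⟨hF, hs⟩ := mdiff_coord hs
  have ht := (mdiff_coord ht).2
  let e := trivializationAt E' (TangentSpace J : N → Type _) (F x)
  have hx : F x ∈ e.baseSet := FiberBundle.mem_baseSet_trivializationAt' (F x)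
  refine (mdifferentiableAt_totalSpace J (E := (TangentSpace J : N → Type _)) _).2 ⟨hF, ?_⟩
  refine (hs.add ht).congr_of_eventuallyEq ?_
  filter_upwards [hF.continuousAt (e.open_baseSet.mem_nhds hx)] with y hy
  exact (e.linear ℝ hy).map_add _ _

lemma mdifferentiableAt_smul_along {f : M → ℝ} {s : Π x : M, TangentSpace J (F x)}
    (hf : MDiffAt f x)
    (hs : MDifferentiableAt I J.tangent (fun y => (⟨F y, s y⟩ : TangentBundle J N)) x) :
    MDifferentiableAt I J.tangent (fun y => (⟨F y, f y • s y⟩ : TangentBundle J N)) x := by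
  obtain ⟨hF, hs⟩ := mdiff_coord hs
  let e := trivializationAt E' (TangentSpace J : N → Type _) (F x)
  have hx : F x ∈ e.baseSet := FiberBundle.mem_baseSet_trivializationAt' (F x)
  refine (mdifferentiableAt_totalSpace J (E := (TangentSpace J : N → Type _)) _).2 ⟨hF, ?_⟩
  refine (hf.smul hs).congr_of_eventuallyEq ?_
  filter_upwards [hF.continuousAt (e.open_baseSet.mem_nhds hx)] with y hy
  exact (e.linear ℝ hy).map_smul _ _

/-- Differentiable vector fields along `F` are built locally, by sums and products with functions,
from vector fields on the target. -/
theorem along_induction {P : (Π x : M, TangentSpace J (F x)) → Prop}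
    (hcomp : ∀ Z : Π q : N, TangentSpace J q, MDiffAt (T% Z) (F x) → P fun y => Z (F y))
    (hadd : ∀ s t : Π x : M, TangentSpace J (F x),
      MDifferentiableAt I J.tangent (fun y => (⟨F y, s y⟩ : TangentBundle J N)) x →
      MDifferentiableAt I J.tangent (fun y => (⟨F y, t y⟩ : TangentBundle J N)) x →
      P s → P t → P fun y => s y + t y)
    (hsmul : ∀ (f : M → ℝ) (s : Π x : M, TangentSpace J (F x)), MDiffAt f x →
      MDifferentiableAt I J.tangent (fun y => (⟨F y, s y⟩ : TangentBundle J N)) x →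
      P s → P fun y => f y • s y)
    (hcongr : ∀ s t : Π x : M, TangentSpace J (F x), (∀ᶠ y in nhds x, s y = t y) → P s → P t)
    {s : Π x : M, TangentSpace J (F x)}
    (hs : MDifferentiableAt I J.tangent (fun y => (⟨F y, s y⟩ : TangentBundle J N)) x) : P s := by
  classical
  obtain ⟨hF, hζ⟩ := mdiff_coord hs
  let e := trivializationAt E' (TangentSpace J : N → Type _) (F x)
  let b := Module.finBasis ℝ E'
  have hq : F x ∈ e.baseSet := FiberBundle.mem_baseSet_trivializationAt' (F x)
  let l : Fin (Module.finrank ℝ E') → E' →L[ℝ] ℝ := fun i =>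
    LinearMap.toContinuousLinearMap (b.coord i)
  have hl : ∀ w : E', ∑ i, l i w • b i = w := fun w => b.sum_repr w
  let f : Fin (Module.finrank ℝ E') → M → ℝ := fun i y => l i (e ⟨F y, s y⟩).2
  let σ : Fin (Module.finrank ℝ E') → Π p : N, TangentSpace J p := fun i =>
    FiberBundle.extend E' (e.symmL ℝ (F x) (b i))
  have hσ : ∀ i, MDiffAt (T% (σ i)) (F x) := fun i => FiberBundle.mdifferentiableAt_extend ..
  have hf : ∀ i, MDiffAt (f i) x := fun i => ((l i).differentiableAt.mdifferentiableAt).comp x hζ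
  have hσF : ∀ i, MDifferentiableAt I J.tangent
      (fun y => (⟨F y, σ i (F y)⟩ : TangentBundle J N)) x := fun i => (hσ i).comp x hF
  have hsum : ∀ t : Finset (Fin (Module.finrank ℝ E')),
      MDifferentiableAt I J.tangent
        (fun y => (⟨F y, ∑ i ∈ t, f i y • σ i (F y)⟩ : TangentBundle J N)) x ∧
      P fun y => ∑ i ∈ t, f i y • σ i (F y) := by
    intro t
    induction t using Finset.induction_on with
    | empty =>
      have h0 : MDiffAt (T% (0 : Π q : N, TangentSpace J q)) (F x) :=
        mdifferentiableAt_zeroSection ℝ (TangentSpace J : N → Type _)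
      simp only [Finset.sum_empty]
      exact ⟨h0.comp x hF, hcomp 0 h0⟩
    | insert i t hi ih =>
      simp only [Finset.sum_insert hi]
      have h1 := mdifferentiableAt_smul_along (hf i) (hσF i)
      exact ⟨mdifferentiableAt_add_along h1 ih.1,
        hadd _ _ h1 ih.1 (hsmul _ _ (hf i) (hσF i) (hcomp _ (hσ i))) ih.2⟩
  refine hcongr _ _ ?_ (hsum Finset.univ).2
  filter_upwards [hF.continuousAt (e.open_baseSet.mem_nhds hq)] with y hy
  have hσ' : ∀ i, σ i (F y) = e.symmL ℝ (F y) (b i) := by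
    intro i
    change FiberBundle.extend E' (e.symmL ℝ (F x) (b i)) (F y) = _
    rw [extend_eq _ hy, Trivialization.symmL_apply _ hq, e.apply_mk_symm hq]
  simp only [hσ', ← map_smul, ← map_sum]
  simp only [f, hl]
  rw [Trivialization.symmL_apply _ hy, e.symm_apply_apply_mk hy]

variable [RiemannianBundle (fun q : N => TangentSpace J q)]
  [IsContMDiffRiemannianBundle J ∞ E' (fun q : N => TangentSpace J q)]

lemma mdifferentiableAt_inner_along {s t : Π x : M, TangentSpace J (F x)}
    (hs : MDifferentiableAt I J.tangent (fun y => (⟨F y, s y⟩ : TangentBundle J N)) x)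
    (ht : MDifferentiableAt I J.tangent (fun y => (⟨F y, t y⟩ : TangentBundle J N)) x) :
    MDiffAt (fun y => (inner ℝ (s y) (t y) : ℝ)) x :=
  MDifferentiableAt.inner_bundle (E := fun q : N => TangentSpace J q) (b := F) hs ht

/-- Metric compatibility of the pullback connection, for a fixed second section, follows from the
case where the first section comes from the target. -/
lemma pullbackCov_metric_of_comp {cov : CovariantDerivative J E' (TangentSpace J : N → Type _)}
    {t : Π x : M, TangentSpace J (F x)} {v : TangentSpace I x}
    (ht : MDifferentiableAt I J.tangent (fun y => (⟨F y, t y⟩ : TangentBundle J N)) x)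
    (hcomp : ∀ Z : Π q : N, TangentSpace J q, MDiffAt (T% Z) (F x) →
      d% (fun y => (inner ℝ (Z (F y)) (t y) : ℝ)) x v =
        inner ℝ (pullbackCov I cov F (fun y => Z (F y)) x v) (t x) +
          inner ℝ (Z (F x)) (pullbackCov I cov F t x v))
    {s : Π x : M, TangentSpace J (F x)}
    (hs : MDifferentiableAt I J.tangent (fun y => (⟨F y, s y⟩ : TangentBundle J N)) x) :
    d% (fun y => (inner ℝ (s y) (t y) : ℝ)) x v =
      inner ℝ (pullbackCov I cov F s x v) (t x) + inner ℝ (s x) (pullbackCov I cov F t x v) := by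
  refine along_induction (P := fun s => d% (fun y => (inner ℝ (s y) (t y) : ℝ)) x v =
    inner ℝ (pullbackCov I cov F s x v) (t x) + inner ℝ (s x) (pullbackCov I cov F t x v))
    hcomp ?_ ?_ ?_ hs
  · intro s s' hs hs' h h'
    have : (fun y => (inner ℝ (s y + s' y) (t y) : ℝ)) =
        (fun y => (inner ℝ (s y) (t y) : ℝ)) + fun y => (inner ℝ (s' y) (t y) : ℝ) := by
      funext y; exact inner_add_left _ _ _
    rw [this, mvfderiv_add (mdifferentiableAt_inner_along hs ht)
      (mdifferentiableAt_inner_along hs' ht), pullbackCov_add hs hs', add_apply, add_apply, h, h',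
      inner_add_left, inner_add_left]
    ring
  · intro f s hf hs h
    have : (fun y => (inner ℝ (f y • s y) (t y) : ℝ)) =
        f * fun y => (inner ℝ (s y) (t y) : ℝ) := by
      funext y; exact real_inner_smul_left _ _ _
    rw [this, mvfderiv_mul hf (mdifferentiableAt_inner_along hs ht), pullbackCov_smul hf hs]
    simp only [add_apply, smul_apply, h, inner_add_left, real_inner_smul_left, smul_eq_mul]
    ring
  · intro s s' hss h
    have h1 : d% (fun y => (inner ℝ (s y) (t y) : ℝ)) x =
        d% (fun y => (inner ℝ (s' y) (t y) : ℝ)) x :=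
      Filter.EventuallyEq.mfderiv_eq (hss.mono fun y hy => by simp only [hy])
    rw [← h1, ← pullbackCov_congr hss, ← hss.self_of_nhds, h]

/-- The pullback of the Levi-Civita connection is compatible with the metric. -/
theorem pullbackCov_metric {s t : Π x : M, TangentSpace J (F x)}
    (hs : MDifferentiableAt I J.tangent (fun y => (⟨F y, s y⟩ : TangentBundle J N)) x)
    (ht : MDifferentiableAt I J.tangent (fun y => (⟨F y, t y⟩ : TangentBundle J N)) x)
    (v : TangentSpace I x) :
    d% (fun y => (inner ℝ (s y) (t y) : ℝ)) x v =
      inner ℝ (pullbackCov I (leviCivita J N) F s x v) (t x) +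
        inner ℝ (s x) (pullbackCov I (leviCivita J N) F t x v) := by
  have hF := (mdiff_coord hs).1
  refine pullbackCov_metric_of_comp ht (fun Z hZ => ?_) hs
  have hZF : MDifferentiableAt I J.tangent (fun y => (⟨F y, Z (F y)⟩ : TangentBundle J N)) x :=
    hZ.comp x hF
  have hcomm : (fun y => (inner ℝ (Z (F y)) (t y) : ℝ)) = fun y => inner ℝ (t y) (Z (F y)) := by
    funext y; exact real_inner_comm _ _
  rw [hcomm, pullbackCov_metric_of_comp (cov := leviCivita J N) hZF (fun W hW => ?_) ht,
    real_inner_comm (Z (F x)), real_inner_comm (t x), add_comm]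
  rw [pullbackCov_comp hF hZ, pullbackCov_comp hF hW]
  have hext : MDiffAt (T% (FiberBundle.extend E' (mfderiv I J F x v))) (F x) :=
    FiberBundle.mdifferentiableAt_extend J E' (mfderiv I J F x v)
  have h := leviCivita_metric (I := J) hext hW hZ
  rw [FiberBundle.extend_apply_self] at h
  rw [← h]
  exact congrArg (fun T => T v) (mfderiv_comp x (mdiff_ip hW hZ) hF)

end PullbackMetric

section SecondFundamentalForm

variable {E : Type*} [NormedAddCommGroup E] [NormedSpace ℝ E] [FiniteDimensional ℝ E]
  {H : Type*} [TopologicalSpace H] {I : ModelWithCorners ℝ E H}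
  {M : Type*} [TopologicalSpace M] [ChartedSpace H M] [IsManifold I ∞ M]
  [RiemannianBundle (fun x : M => TangentSpace I x)]
  [IsContMDiffRiemannianBundle I ∞ E (fun x : M => TangentSpace I x)]
  {E' : Type*} [NormedAddCommGroup E'] [NormedSpace ℝ E'] [FiniteDimensional ℝ E']
  {H' : Type*} [TopologicalSpace H'] {J : ModelWithCorners ℝ E' H'}
  {N : Type*} [TopologicalSpace N] [ChartedSpace H' N] [IsManifold J ∞ N]
  [RiemannianBundle (fun q : N => TangentSpace J q)]
  [IsContMDiffRiemannianBundle J ∞ E' (fun q : N => TangentSpace J q)]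
  {F : M → N} {X X' Y Y' Z : Π x : M, TangentSpace I x}

lemma mdifferentiableAt_mfderiv_apply (hF : ContMDiff I J ∞ F)
    (hX : ContMDiff I I.tangent ∞ (T% X)) (x : M) :
    MDifferentiableAt I J.tangent
      (fun y => (⟨F y, mfderiv I J F y (X y)⟩ : TangentBundle J N)) x :=
  (contMDiff_mfderiv_apply hF (hX x)).mdifferentiableAt (by simp)

lemma secondFundamentalForm_add_left (x : M) :
    secondFundamentalForm I J F (fun y => X y + X' y) Y x =
      secondFundamentalForm I J F X Y x + secondFundamentalForm I J F X' Y x := by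
  simp only [secondFundamentalForm, nabla, map_add]
  abel

lemma secondFundamentalForm_add_right (hF : ContMDiff I J ∞ F)
    (hY : ContMDiff I I.tangent ∞ (T% Y)) (hY' : ContMDiff I I.tangent ∞ (T% Y')) (x : M) :
    secondFundamentalForm I J F X (fun y => Y y + Y' y) x =
      secondFundamentalForm I J F X Y x + secondFundamentalForm I J F X Y' x := by
  have h : leviCivita I M (fun y => Y y + Y' y) x = leviCivita I M Y x + leviCivita I M Y' x :=
    (leviCivita I M).isCovariantDerivativeOnUniv.add (mdifferentiableAt_of_contMDiff hY x)
      (mdifferentiableAt_of_contMDiff hY' x)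
  simp only [secondFundamentalForm, nabla, map_add]
  rw [pullbackCov_add (mdifferentiableAt_mfderiv_apply hF hY x)
    (mdifferentiableAt_mfderiv_apply hF hY' x), h]
  simp only [add_apply, map_add]
  abel

/-- The second fundamental form is symmetric. -/
theorem secondFundamentalForm_symm [I.Boundaryless] [J.Boundaryless] (hF : ContMDiff I J ∞ F)
    (hX : ContMDiff I I.tangent ∞ (T% X)) (hY : ContMDiff I I.tangent ∞ (T% Y)) (x : M) :
    secondFundamentalForm I J F X Y x = secondFundamentalForm I J F Y X x := by
  have hX' := mdifferentiableAt_of_contMDiff hX x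
  have hY' := mdifferentiableAt_of_contMDiff hY x
  have h := pullbackCov_torsion hF hX' hY'
  rw [← leviCivita_torsion hX' hY', map_sub] at h
  simp only [secondFundamentalForm, nabla]
  rw [sub_eq_sub_iff_sub_eq_sub, h]

lemma secondFundamentalForm_vertical (hF : ContMDiff I J ∞ F) {V : Π x : M, TangentSpace I x}
    (hV : ∀ x, V x ∈ vertical I J F x) (x : M) :
    secondFundamentalForm I J F X V x = - mfderiv I J F x (nabla I X V x) := by
  have h : (fun y => mfderiv I J F y (V y)) = fun _ => 0 := by
    funext y; exact mem_vertical.1 (hV y)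
  rw [secondFundamentalForm, h, pullbackCov_zero ((hF x).mdifferentiableAt (by simp)), zero_sub]

lemma IsRiemannianSubmersion.inner_secondFundamentalForm_swap
    (hF : IsRiemannianSubmersion I J F) (hX : ContMDiff I I.tangent ∞ (T% X))
    (hY : IsHorizontalField I J F Y) (hZ : IsHorizontalField I J F Z) (x : M) :
    inner ℝ (secondFundamentalForm I J F X Y x) (mfderiv I J F x (Z x)) =
      - inner ℝ (secondFundamentalForm I J F X Z x) (mfderiv I J F x (Y x)) := by
  have h1 := leviCivita_metric (mdifferentiableAt_of_contMDiff hX x)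
    (mdifferentiableAt_of_contMDiff hY.1 x) (mdifferentiableAt_of_contMDiff hZ.1 x)
  have h2 := pullbackCov_metric (mdifferentiableAt_mfderiv_apply hF.contMDiff hY.1 x)
    (mdifferentiableAt_mfderiv_apply hF.contMDiff hZ.1 x) (X x)
  have h3 : (fun y => (inner ℝ (mfderiv I J F y (Y y)) (mfderiv I J F y (Z y)) : ℝ)) =
      fun y => inner ℝ (Y y) (Z y) := by
    funext y; exact hF.inner_mfderiv (hY.2 y)
  rw [h3, h1] at h2
  simp only [secondFundamentalForm, nabla, inner_sub_left]
  rw [real_inner_comm _ (mfderiv I J F x (leviCivita I M Y x (X x))), hF.inner_mfderiv (hZ.2 x),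
    real_inner_comm _ (mfderiv I J F x (leviCivita I M Z x (X x))), hF.inner_mfderiv (hY.2 x),
    real_inner_comm (leviCivita I M Y x (X x))]
  rw [real_inner_comm _ (mfderiv I J F x (Y x))] at h2
  linarith

/-- The second fundamental form of a Riemannian submersion vanishes on horizontal vector fields. -/
theorem IsRiemannianSubmersion.secondFundamentalForm_horizontal [T2Space M] [I.Boundaryless]
    [J.Boundaryless] (hF : IsRiemannianSubmersion I J F) (hX : IsHorizontalField I J F X)
    (hY : IsHorizontalField I J F Y) (x : M) : secondFundamentalForm I J F X Y x = 0 := by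
  refine ext_inner_right ℝ fun w => ?_
  obtain ⟨z, rfl⟩ := hF.surjective_mfderiv x w
  obtain ⟨Z', hZ', rfl⟩ := exists_contMDiff_vectorField_eq x z
  rw [← mfderiv_horPart, inner_zero_left]
  have hZ : IsHorizontalField I J F (horPart I J F Z') := ⟨hF.contMDiff_horPart hZ', horPart_mem Z'⟩
  have s := fun {A B : Π x : M, TangentSpace I x} (hA : IsHorizontalField I J F A)
    (hB : IsHorizontalField I J F B) => secondFundamentalForm_symm hF.contMDiff hA.1 hB.1 x
  have h1 := hF.inner_secondFundamentalForm_swap hX.1 hY hZ x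
  have h2 := hF.inner_secondFundamentalForm_swap hZ.1 hX hY x
  have h3 := hF.inner_secondFundamentalForm_swap hY.1 hZ hX x
  rw [s hX hZ] at h1
  rw [s hZ hY] at h2
  rw [s hY hX] at h3
  linarith

end SecondFundamentalForm

section Cosymplectic

variable {E : Type*} [NormedAddCommGroup E] [NormedSpace ℝ E] [FiniteDimensional ℝ E]
  {H : Type*} [TopologicalSpace H] {I : ModelWithCorners ℝ E H}
  {M : Type*} [TopologicalSpace M] [ChartedSpace H M] [IsManifold I ∞ M]
  [RiemannianBundle (fun x : M => TangentSpace I x)]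
  [IsContMDiffRiemannianBundle I ∞ E (fun x : M => TangentSpace I x)]

namespace AlmostContactMetricStructure

variable (S : AlmostContactMetricStructure I M) {X Z : Π x : M, TangentSpace I x}

lemma inner_phi (x : M) (v w : TangentSpace I x) :
    inner ℝ v (S.phi x w) = - inner ℝ (S.phi x v) w := by
  have h := S.inner_phi_phi x v (S.phi x w)
  rw [S.eta_phi, mul_zero, sub_zero, S.phi_phi, inner_add_right, inner_neg_right,
    real_inner_smul_right, ← S.eta_eq_inner, S.eta_phi, mul_zero, add_zero] at h
  exact h.symm

lemma contMDiff_phi_apply (hX : ContMDiff I I.tangent ∞ (T% X)) :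
    ContMDiff I I.tangent ∞ (T% (fun x => S.phi x (X x))) :=
  ContMDiff.clm_bundle_apply (E₁ := fun x : M => TangentSpace I x)
    (E₂ := fun x : M => TangentSpace I x) (b := id) S.contMDiff_phi hX

variable {S}

lemma IsCosymplectic.deta_zero (hS : S.IsCosymplectic) (hX : ContMDiff I I.tangent ∞ (T% X))
    (hZ : ContMDiff I I.tangent ∞ (T% Z)) (x : M) :
    S.eta x (VectorField.mlieBracket I X Z x) =
      d% (fun y => S.eta y (Z y)) x (X x) - d% (fun y => S.eta y (X y)) x (Z x) := by
  have h := hS.closed_eta X Z hX hZ x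
  rw [extDerivOne] at h
  linarith

lemma IsCosymplectic.eta_mlieBracket_xi (hS : S.IsCosymplectic)
    (hX : ContMDiff I I.tangent ∞ (T% X)) (x : M) :
    S.eta x (VectorField.mlieBracket I X S.xi x) =
      - d% (fun y => S.eta y (X y)) x (S.xi x) := by
  have h := hS.deta_zero hX S.contMDiff_xi x
  simp only [S.eta_xi, mvfderiv_const] at h
  rw [h]
  simp

/-- The Lie derivative of `φ` along `ξ` vanishes. -/
lemma IsCosymplectic.phi_mlieBracket_xi (hS : S.IsCosymplectic)
    (hX : ContMDiff I I.tangent ∞ (T% X)) (x : M) :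
    S.phi x (VectorField.mlieBracket I X S.xi x) =
      VectorField.mlieBracket I (fun y => S.phi y (X y)) S.xi x := by
  have h := hS.normal X S.xi hX S.contMDiff_xi x
  rw [hS.closed_eta X S.xi hX S.contMDiff_xi x, mul_zero, zero_smul, add_zero, nijenhuis] at h
  have h0 : (fun y => S.phi y (S.xi y)) = (0 : Π x : M, TangentSpace I x) := by
    funext y; exact S.phi_xi y
  simp only [h0, VectorField.mlieBracket_zero_right, Pi.zero_apply, map_zero, add_zero,
    sub_zero] at h
  rw [← map_sub] at h
  have h2 := congrArg (S.phi x) h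
  rw [S.phi_phi, map_zero, map_sub (S.eta x), S.eta_phi,
    hS.eta_mlieBracket_xi (S.contMDiff_phi_apply hX)] at h2
  simp only [S.eta_phi, mvfderiv_const] at h2
  simp only [zero_apply, neg_zero, sub_self, zero_smul, add_zero] at h2
  exact sub_eq_zero.1 (neg_eq_zero.1 h2)

/-- The characteristic vector field of a cosymplectic structure is Killing. -/
lemma IsCosymplectic.koszul_xi_phi (hS : S.IsCosymplectic)
    (hX : ContMDiff I I.tangent ∞ (T% X)) (hZ : ContMDiff I I.tangent ∞ (T% Z)) (x : M) :
    koszul S.xi X (fun y => S.phi y (Z y)) x = 0 := by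
  have hφZ := S.contMDiff_phi_apply hZ
  have h1 := hS.closed_fundamentalForm S.xi X Z S.contMDiff_xi hX hZ x
  have h2 := hS.deta_zero hX hφZ x
  have e1 : ip S.xi (fun y => S.phi y (Z y)) = fun _ => (0 : ℝ) := by
    funext y
    rw [ip, real_inner_comm, ← S.eta_eq_inner, S.eta_phi]
  have e2 : ip X S.xi = fun y => S.eta y (X y) := by
    funext y
    rw [ip, ← S.eta_eq_inner]
  have e3 : (fun y => S.fundamentalForm y (Z y) (S.xi y)) = fun _ => (0 : ℝ) := by
    funext y
    rw [fundamentalForm, S.phi_xi, inner_zero_right]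
  have e4 : (fun y => S.fundamentalForm y (S.xi y) (X y)) = fun _ => (0 : ℝ) := by
    funext y
    rw [fundamentalForm, real_inner_comm, ← S.eta_eq_inner, S.eta_phi]
  have e5 : (fun y => S.fundamentalForm y (X y) (Z y)) = ip X (fun y => S.phi y (Z y)) := rfl
  simp only [S.eta_phi, mvfderiv_const] at h2
  rw [extDerivTwo, e3, e4, e5] at h1
  simp only [fundamentalForm, S.phi_xi, inner_zero_right, mvfderiv_const] at h1
  rw [S.inner_phi x (VectorField.mlieBracket I Z S.xi x), hS.phi_mlieBracket_xi hZ] at h1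
  rw [koszul, e1, e2, VectorField.mlieBracket_swap_apply (V := S.xi) (W := fun y => S.phi y (Z y)),
    VectorField.mlieBracket_swap_apply (V := X) (W := S.xi), ← S.eta_eq_inner, h2, mvfderiv_const]
  simp only [inner_neg_left, zero_apply] at h1 ⊢
  linarith

/-- The characteristic vector field of a cosymplectic structure is parallel. -/
theorem IsCosymplectic.nabla_xi [T2Space M] (hS : S.IsCosymplectic)
    (hX : ContMDiff I I.tangent ∞ (T% X)) (x : M) : nabla I X S.xi x = 0 := by
  have hξ := mdifferentiableAt_of_contMDiff S.contMDiff_xi x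
  have hX' := mdifferentiableAt_of_contMDiff hX x
  have hphi : ∀ w, inner ℝ (nabla I X S.xi x) (S.phi x w) = 0 := by
    intro w
    obtain ⟨Z, hZ, rfl⟩ := exists_contMDiff_vectorField_eq x w
    exact (inner_leviCivitaFun hX' hξ
      (mdifferentiableAt_of_contMDiff (S.contMDiff_phi_apply hZ) x)).trans
      (hS.koszul_xi_phi hX hZ x)
  have hxi : inner ℝ (nabla I X S.xi x) (S.xi x) = 0 := by
    have h := leviCivita_metric hX' hξ hξ
    have e : (fun y => (inner ℝ (S.xi y) (S.xi y) : ℝ)) = fun _ => 1 := by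
      funext y
      rw [← S.eta_eq_inner, S.eta_xi]
    rw [e, mvfderiv_const, real_inner_comm _ (S.xi x), zero_apply] at h
    rw [nabla]
    linarith
  refine ext_inner_right ℝ fun w => ?_
  have hw : w = S.eta x w • S.xi x - S.phi x (S.phi x w) := by
    rw [S.phi_phi]
    abel
  rw [hw, inner_sub_right, real_inner_smul_right, hxi, hphi, inner_zero_left]
  ring

end AlmostContactMetricStructure

end Cosymplectic

section Tensors

variable {E : Type*} [NormedAddCommGroup E] [NormedSpace ℝ E] [FiniteDimensional ℝ E]
  {H : Type*} [TopologicalSpace H] {I : ModelWithCorners ℝ E H}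
  {M : Type*} [TopologicalSpace M] [ChartedSpace H M] [IsManifold I ∞ M]
  [RiemannianBundle (fun x : M => TangentSpace I x)]
  [IsContMDiffRiemannianBundle I ∞ E (fun x : M => TangentSpace I x)]
  {E' : Type*} [NormedAddCommGroup E'] [NormedSpace ℝ E'] [FiniteDimensional ℝ E']
  {H' : Type*} [TopologicalSpace H'] {J : ModelWithCorners ℝ E' H'}
  {N : Type*} [TopologicalSpace N] [ChartedSpace H' N] [IsManifold J ∞ N]
  [RiemannianBundle (fun q : N => TangentSpace J q)]
  [IsContMDiffRiemannianBundle J ∞ E' (fun q : N => TangentSpace J q)]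
  {F : M → N} {X Y V : Π x : M, TangentSpace I x}

lemma verPart_of_vertical (hV : ∀ x, V x ∈ vertical I J F x) : verPart I J F V = V := by
  funext x
  exact Submodule.starProjection_eq_self_iff.2 (hV x)

lemma horPart_of_horizontal (hY : ∀ x, Y x ∈ (vertical I J F x)ᗮ) : horPart I J F Y = Y := by
  funext x
  exact Submodule.starProjection_eq_self_iff.2 (hY x)

lemma verPart_of_horizontal (hY : ∀ x, Y x ∈ (vertical I J F x)ᗮ) : verPart I J F Y = 0 := by
  funext x
  exact (Submodule.starProjection_apply_eq_zero_iff _).2 (hY x)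

lemma nabla_zero : nabla I X 0 = 0 := by
  funext x
  rw [nabla, (leviCivita I M).zero]
  rfl

lemma tensorT_vertical_horizontal (hV : ∀ x, V x ∈ vertical I J F x)
    (hY : ∀ x, Y x ∈ (vertical I J F x)ᗮ) (x : M) :
    tensorT I J F V Y x = verPart I J F (nabla I V Y) x := by
  rw [tensorT, verPart_of_vertical hV, horPart_of_horizontal hY, verPart_of_horizontal hY,
    nabla_zero]
  simp [horPart]

lemma tensorA_horizontal_horizontal (hX : ∀ x, X x ∈ (vertical I J F x)ᗮ)
    (hY : ∀ x, Y x ∈ (vertical I J F x)ᗮ) (x : M) :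
    tensorA I J F X Y x = verPart I J F (nabla I X Y) x := by
  rw [tensorA, horPart_of_horizontal hX, horPart_of_horizontal hY, verPart_of_horizontal hY,
    nabla_zero]
  simp [horPart]

/-- For `U` vertical and `Y` horizontal, `g(∇_X Y, U) = - g(Y, ∇_X U)`. -/
lemma inner_nabla_swap {U : Π x : M, TangentSpace I x} (hX : ContMDiff I I.tangent ∞ (T% X))
    (hU : IsVerticalField I J F U) (hY : IsHorizontalField I J F Y) (x : M) :
    inner ℝ (nabla I X Y x) (U x) = - inner ℝ (Y x) (nabla I X U x) := by
  have h := leviCivita_metric (mdifferentiableAt_of_contMDiff hX x)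
    (mdifferentiableAt_of_contMDiff hY.1 x) (mdifferentiableAt_of_contMDiff hU.1 x)
  have e : (fun y => (inner ℝ (Y y) (U y) : ℝ)) = fun _ => 0 := by
    funext y
    exact (Submodule.mem_orthogonal' _ _).1 (hY.2 y) _ (hU.2 y)
  rw [e, mvfderiv_const, zero_apply] at h
  simp only [nabla]
  linarith

/-- The covariant derivatives of the fields `φ V`, `V` vertical, along `X` have no vertical part if
and only if the covariant derivatives of vertical fields along `X` are vertical. -/
lemma verPart_nabla_phi_eq_zero_iff [T2Space M] {S : AlmostContactMetricStructure I M}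
    (hS : S.IsCosymplectic) (hF : IsRiemannianSubmersion I J F) (hanti : IsAntiInvariant J S F)
    (hsum : ∀ x : M, (vertical I J F x)ᗮ =
      (vertical I J F x).map (S.phi x : TangentSpace I x →ₗ[ℝ] TangentSpace I x)
        ⊔ Submodule.span ℝ {S.xi x}) (hX : ContMDiff I I.tangent ∞ (T% X)) (x : M) :
    (∀ V, IsVerticalField I J F V → verPart I J F (nabla I X (fun y => S.phi y (V y))) x = 0) ↔
      ∀ U, IsVerticalField I J F U → nabla I X U x ∈ vertical I J F x := by
  have hφ : ∀ V, IsVerticalField I J F V → IsHorizontalField I J F (fun y => S.phi y (V y)) :=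
    fun V hV => ⟨S.contMDiff_phi_apply hV.1,
      fun y => hanti y (Submodule.mem_map_of_mem (hV.2 y))⟩
  constructor
  · intro h U hU
    rw [← (vertical I J F x).orthogonal_orthogonal, Submodule.mem_orthogonal, hsum x]
    intro w hw
    obtain ⟨_, ⟨v, hv, rfl⟩, _, hc, rfl⟩ := Submodule.mem_sup.1 hw
    obtain ⟨c, rfl⟩ := Submodule.mem_span_singleton.1 hc
    obtain ⟨V, hV, rfl⟩ := hF.exists_isVerticalField_eq hv
    have hξ : IsHorizontalField I J F S.xi := ⟨S.contMDiff_xi, fun y => by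
      rw [hsum y]
      exact Submodule.mem_sup_right (Submodule.mem_span_singleton_self _)⟩
    have h1 := inner_nabla_swap hX hU (hφ V hV) x
    have h2 := inner_nabla_swap hX hU hξ x
    rw [hS.nabla_xi hX, inner_zero_left] at h2
    have h3 := (Submodule.starProjection_apply_eq_zero_iff _).1 (h V hV)
    rw [(Submodule.mem_orthogonal' _ _).1 h3 _ (hU.2 x)] at h1
    rw [inner_add_left, real_inner_smul_left, neg_eq_zero.1 h2.symm, mul_zero, add_zero]
    exact neg_eq_zero.1 h1.symm
  · intro h V hV
    refine (Submodule.starProjection_apply_eq_zero_iff _).2 ((Submodule.mem_orthogonal' _ _).2 ?_)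
    intro u hu
    obtain ⟨U, hU, rfl⟩ := hF.exists_isVerticalField_eq hu
    rw [inner_nabla_swap hX hU (hφ V hV),
      (Submodule.mem_orthogonal' _ _).1 ((hφ V hV).2 x) _ (h U hU), neg_zero]

/-- A Riemannian submersion is totally geodesic if and only if the covariant derivatives of vertical
vector fields along vertical and along horizontal vector fields are vertical. -/
theorem IsRiemannianSubmersion.isTotallyGeodesic_iff [T2Space M] [I.Boundaryless] [J.Boundaryless]
    (hF : IsRiemannianSubmersion I J F) :
    IsTotallyGeodesic I J F ↔
      (∀ W, IsVerticalField I J F W → ∀ U, IsVerticalField I J F U →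
        ∀ x, nabla I W U x ∈ vertical I J F x) ∧
      (∀ X, IsHorizontalField I J F X → ∀ U, IsVerticalField I J F U →
        ∀ x, nabla I X U x ∈ vertical I J F x) := by
  constructor
  · intro h
    have key : ∀ X : Π x : M, TangentSpace I x, ContMDiff I I.tangent ∞ (T% X) → ∀ U, IsVerticalField I J F U →
        ∀ x, nabla I X U x ∈ vertical I J F x := by
      intro X hX U hU x
      have h1 := h X U hX hU.1 x
      rwa [secondFundamentalForm_vertical hF.contMDiff hU.2, neg_eq_zero] at h1
    exact ⟨fun W hW => key W hW.1, fun X hX => key X hX.1⟩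
  · rintro ⟨hv, hh⟩ X Y hX hY x
    have hXv : IsVerticalField I J F (verPart I J F X) := ⟨hF.contMDiff_verPart hX, verPart_mem X⟩
    have hYv : IsVerticalField I J F (verPart I J F Y) := ⟨hF.contMDiff_verPart hY, verPart_mem Y⟩
    have hXh : IsHorizontalField I J F (horPart I J F X) :=
      ⟨hF.contMDiff_horPart hX, horPart_mem X⟩
    have hYh : IsHorizontalField I J F (horPart I J F Y) :=
      ⟨hF.contMDiff_horPart hY, horPart_mem Y⟩
    have eX : X = fun y => verPart I J F X y + horPart I J F X y := by
      funext y; exact (verPart_add_horPart X y).symm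
    have eY : Y = fun y => verPart I J F Y y + horPart I J F Y y := by
      funext y; exact (verPart_add_horPart Y y).symm
    rw [eX, eY, secondFundamentalForm_add_left,
      secondFundamentalForm_add_right hF.contMDiff hYv.1 hYh.1,
      secondFundamentalForm_add_right hF.contMDiff hYv.1 hYh.1,
      hF.secondFundamentalForm_horizontal hXh hYh,
      secondFundamentalForm_symm hF.contMDiff hXv.1 hYh.1,
      secondFundamentalForm_vertical hF.contMDiff hYv.2,
      secondFundamentalForm_vertical hF.contMDiff hYv.2,
      secondFundamentalForm_vertical hF.contMDiff hXv.2,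
      mem_vertical.1 (hv _ hXv _ hYv x), mem_vertical.1 (hh _ hYh _ hXv x),
      mem_vertical.1 (hh _ hXh _ hYv x)]
    simp

end Tensors

end CosymplecticSubmersion

theorem theorem15
    {E : Type*} [NormedAddCommGroup E] [NormedSpace ℝ E] [FiniteDimensional ℝ E]
    {H : Type*} [TopologicalSpace H] (I : ModelWithCorners ℝ E H) [I.Boundaryless]
    {M : Type*} [TopologicalSpace M] [T2Space M] [ChartedSpace H M] [IsManifold I ∞ M]
    [RiemannianBundle (fun x : M => TangentSpace I x)]
    [IsContMDiffRiemannianBundle I ∞ E (fun x : M => TangentSpace I x)]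
    {E' : Type*} [NormedAddCommGroup E'] [NormedSpace ℝ E'] [FiniteDimensional ℝ E']
    {H' : Type*} [TopologicalSpace H'] (J : ModelWithCorners ℝ E' H') [J.Boundaryless]
    {N : Type*} [TopologicalSpace N] [T2Space N] [ChartedSpace H' N] [IsManifold J ∞ N]
    [RiemannianBundle (fun q : N => TangentSpace J q)]
    [IsContMDiffRiemannianBundle J ∞ E' (fun q : N => TangentSpace J q)]
    (S : AlmostContactMetricStructure I M) (hS : S.IsCosymplectic)
    (F : M → N) (hF : IsRiemannianSubmersion I J F) (hanti : IsAntiInvariant J S F)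
    (hsum : ∀ x : M,
      (vertical I J F x)ᗮ =
          (vertical I J F x).map (S.phi x : TangentSpace I x →ₗ[ℝ] TangentSpace I x)
            ⊔ Submodule.span ℝ {S.xi x} ∧
        Disjoint ((vertical I J F x).map (S.phi x : TangentSpace I x →ₗ[ℝ] TangentSpace I x))
          (Submodule.span ℝ {S.xi x})) :
    IsTotallyGeodesic I J F ↔
      (∀ W V : Π x : M, TangentSpace I x, IsVerticalField I J F W → IsVerticalField I J F V →
        ∀ x, tensorT I J F W (fun y => S.phi y (V y)) x = 0) ∧
      (∀ X W : Π x : M, TangentSpace I x, IsHorizontalField I J F X → IsVerticalField I J F W →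
        ∀ x, tensorA I J F X (fun y => S.phi y (W y)) x = 0) := by
  rw [hF.isTotallyGeodesic_iff]
  have hφ : ∀ V, IsVerticalField I J F V → ∀ y, S.phi y (V y) ∈ (vertical I J F y)ᗮ :=
    fun V hV y => hanti y (Submodule.mem_map_of_mem (hV.2 y))
  have key := fun (X : Π x : M, TangentSpace I x) (hX : ContMDiff I I.tangent ∞ (T% X)) =>
    verPart_nabla_phi_eq_zero_iff hS hF hanti (fun x => (hsum x).1) hX
  refine and_congr ⟨fun h W V hW hV x => ?_, fun h W hW U hU x => ?_⟩
    ⟨fun h X W hX hW x => ?_, fun h X hX U hU x => ?_⟩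
  · rw [tensorT_vertical_horizontal hW.2 (hφ V hV)]
    exact (key W hW.1 x).2 (fun U hU => h W hW U hU x) V hV
  · refine (key W hW.1 x).1 (fun V hV => ?_) U hU
    rw [← tensorT_vertical_horizontal hW.2 (hφ V hV)]
    exact h W V hW hV x
  · rw [tensorA_horizontal_horizontal hX.2 (hφ W hW)]
    exact (key X hX.1 x).2 (fun U hU => h X hX U hU x) W hW
  · refine (key X hX.1 x).1 (fun V hV => ?_) U hU
    rw [← tensorA_horizontal_horizontal hX.2 (hφ V hV)]
    exact h X V hX hV x
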